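/- **Theorem.** For every classical knot $K$, the danceability index equals the bridge index: $da(K)=br(K)$. More precisely, the dance-over index and the dance-under index of $K$ both equal the bridge index, $$da^o(K)=da^u(K)=br(K).$$ Here a classical knot $K$ is unoriented, and is given by its diagrams: it is a class of oriented knot diagrams in the plane (or sphere), recorded by signed Gauss codes of genus $0$, under the equivalence relation generated by relabelling, change of orientation, and the Reidemeister moves I, II, III. *Bridge index.* A bridge of a diagram is a maximal unbroken arc (running from one undercrossing to the next) that includes at least one overcrossing. The bridge index $br(K)$ is $1$ if $K$ is the unknot, and otherwise it is the minimum number of bridges over all diagrams of $K$. *Danceability index.* Let $D$ be an oriented diagram and $n\ge 1$. An $n$-dance-over (resp. $n$-dance-under) configuration of $D$ is a choice of $n$ initial points on $D$, away from the crossings, with one dancer starting at each of them. Each dancer moves along $D$ in the direction of the orientation and stops at the next initial point, so that together the dancers traverse $D$ exactly once. It is required that the speeds of the dancers can be chosen so that every crossing is passed on its over-strand strictly before (resp. strictly after) it is passed on its under-strand. Let $da^o(D)$ (resp. $da^u(D)$) be the least $n$ for which $D$ has an $n$-dance-over (resp. $n$-dance-under) configuration, and let $da^o(K)$ (resp. $da^u(K)$)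 be the minimum of $da^o(D)$ (resp. $da^u(D)$) over all diagrams $D$ of $K$ with any orientation. The danceability index $da(K)$ is the common value $da^o(K)=da^u(K)$. -/

import Mathlib

namespace Danceability

/-! ### Oriented classical knot diagrams

An oriented knot diagram is recorded by its signed Gauss code: follow the diagram once in the
direction of its orientation, and write down, for every passage through a crossing, the label of
the crossing, whether it is passed on the over-strand or on the under-strand, and the sign of the
crossing.  The code is cyclic: words that differ by a rotation describe the same diagram.
A signed Gauss code determines the diagram as a combinatorial map (a `4`-regular graph with
a cyclic order of the edges at each vertex); it comes from a classical diagram, one drawn in the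
plane (or sphere), exactly when this map has genus `0`. -/

/-- A passage of the knot through a crossing: the label of the crossing, `isOver = true` on the
over-strand and `isOver = false` on the under-strand, and the sign (writhe) of the crossing. -/
@[ext]
structure Letter where
  crossing : ℕ
  isOver : Bool
  sign : ℤˣ
  deriving DecidableEq

/-- The passage through the same crossing on the other strand. -/
def Letter.other (x : Letter) : Letter := ⟨x.crossing, !x.isOver, x.sign⟩

/-- Rename the crossing. -/
def Letter.relabel (f : Equiv.Perm ℕ) (x : Letter) : Letter := ⟨f x.crossing, x.isOver, x.sign⟩

/-- `w` is a signed Gauss code: every crossing that occurs in `w` is passed exactly once on the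
over-strand and exactly once on the under-strand, with one sign. -/
def IsGaussCode (w : List Letter) : Prop :=
  (w.map fun x => (x.crossing, x.isOver)).Nodup ∧ ∀ x ∈ w, x.other ∈ w

/-- A dart (half-edge) leaving a crossing: `(x, 1)` leaves the crossing of `x` along the strand of
`x` in the direction of the orientation, `(x, -1)` leaves it against the orientation. -/
abbrev Dart : Type := Letter × ℤˣ

/-- The other half of the edge of a dart. (`w.formPerm` sends each letter of the word `w` to the
cyclically next one.) -/
def Dart.flip (w : List Letter) (d : Dart) : Dart :=
  if d.2 = 1 then (w.formPerm d.1, -1) else (w.formPerm.symm d.1, 1)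

/-- The next dart at the same crossing in counterclockwise order.  At a positive crossing the
outgoing under-strand is the next after the outgoing over-strand, and the four darts are, in
counterclockwise order, over-out, under-out, over-back, under-back; at a negative crossing they
are over-out, under-back, over-back, under-out. -/
def Dart.turn (d : Dart) : Dart :=
  (d.1.other, (if d.1.isOver then 1 else -1) * d.1.sign * d.2)

/-- The faces (complementary regions) of the diagram: darts, where a dart is identified with the one
that follows it on the boundary of the face. -/
def Face (w : List Letter) : Type :=
  Quot fun d e : {d : Dart // d.1 ∈ w} => e.1 = Dart.turn (Dart.flip w d.1)

/-- Genus `0`: either there are no crossings (a round circle), or the Euler characteristic is `2`.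
The vertices are the crossings (one over-letter each), and there is one edge after each letter.
The underlying graph is connected because the code is a single cyclic word. -/
def IsPlanar (w : List Letter) : Prop :=
  w = [] ∨ w.countP (fun x => x.isOver) + Nat.card (Face w) = w.length + 2

/-- An oriented classical knot diagram. -/
structure Diagram where
  word : List Letter
  isGaussCode : IsGaussCode word
  isPlanar : IsPlanar word

/-! ### Knots as diagrams up to Reidemeister moves -/

/-- The letters `x`, `y` in this order if `e = 1`, and in the opposite order if `e = -1`. -/
def ordered (e : ℤˣ) (x y : Letter) : List Letter := if e = 1 then [x, y] else [y, x]

/-- Changes of the code that do not change the diagram, change of orientation,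
and the three Reidemeister moves, in all their oriented versions (each is read in both directions).
The labels of new crossings are fresh because both words will be required to be Gauss codes.

* `r1`: a kink, of any kind.
* `r2`: the over-strand passes over the under-strand at `a` and then at `b`, with opposite signs;
  the under-strand runs parallel (`e = 1`) or antiparallel (`e = -1`) to it. The signs make the two
  edges between `a` and `b` bound a bigon.
* `r3`, `r3'`: a top, a middle and a bottom strand; top and middle cross at `a`, top and bottom at
  `b`, middle and bottom at `c`. The top strand meets `a` before `b` iff `e₁ = 1`, the middle strand
  `a` before `c` iff `e₂ = 1`, the bottom strand `b` before `c` iff `e₃ = 1`; the triangle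
  `a`, `b`, `c` is counterclockwise iff `k = 1`, and this determines the signs. The move reverses the
  order of the two crossings on each strand. The two versions are the two cyclic orders in which
  the knot can run through the three strands. -/
inductive Move : List Letter → List Letter → Prop
  | rotate (u v : List Letter) : Move (u ++ v) (v ++ u)
  | relabel (f : Equiv.Perm ℕ) (w : List Letter) : Move w (w.map (Letter.relabel f))
  | reverse (w : List Letter) : Move w w.reverse
  | r1 (a : ℕ) (o : Bool) (s : ℤˣ) (w : List Letter) :
      Move w ([⟨a, o, s⟩, ⟨a, !o, s⟩] ++ w)
  | r2 (a b : ℕ) (s e : ℤˣ) (u v : List Letter) :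
      Move (u ++ v)
        ([⟨a, true, s⟩, ⟨b, true, -s⟩] ++ u ++ ordered e ⟨a, false, s⟩ ⟨b, false, -s⟩ ++ v)
  | r3 (a b c : ℕ) (k e₁ e₂ e₃ : ℤˣ) (u v t : List Letter) :
      Move
        (ordered e₁ ⟨a, true, k * e₁ * e₂⟩ ⟨b, true, k * e₁ * e₃⟩ ++ u ++
          ordered e₂ ⟨a, false, k * e₁ * e₂⟩ ⟨c, true, k * e₂ * e₃⟩ ++ v ++
          ordered e₃ ⟨b, false, k * e₁ * e₃⟩ ⟨c, false, k * e₂ * e₃⟩ ++ t)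
        (ordered (-e₁) ⟨a, true, k * e₁ * e₂⟩ ⟨b, true, k * e₁ * e₃⟩ ++ u ++
          ordered (-e₂) ⟨a, false, k * e₁ * e₂⟩ ⟨c, true, k * e₂ * e₃⟩ ++ v ++
          ordered (-e₃) ⟨b, false, k * e₁ * e₃⟩ ⟨c, false, k * e₂ * e₃⟩ ++ t)
  | r3' (a b c : ℕ) (k e₁ e₂ e₃ : ℤˣ) (u v t : List Letter) :
      Move
        (ordered e₁ ⟨a, true, k * e₁ * e₂⟩ ⟨b, true, k * e₁ * e₃⟩ ++ u ++
          ordered e₃ ⟨b, false, k * e₁ * e₃⟩ ⟨c, false, k * e₂ * e₃⟩ ++ v ++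
          ordered e₂ ⟨a, false, k * e₁ * e₂⟩ ⟨c, true, k * e₂ * e₃⟩ ++ t)
        (ordered (-e₁) ⟨a, true, k * e₁ * e₂⟩ ⟨b, true, k * e₁ * e₃⟩ ++ u ++
          ordered (-e₃) ⟨b, false, k * e₁ * e₃⟩ ⟨c, false, k * e₂ * e₃⟩ ++ v ++
          ordered (-e₂) ⟨a, false, k * e₁ * e₂⟩ ⟨c, true, k * e₂ * e₃⟩ ++ t)

/-- Unoriented classical knots: classical diagrams, up to the equivalence relation generated by the
moves (all intermediate diagrams being classical, too). -/
def Knot : Type := Quot fun D E : Diagram => Move D.word E.word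

/-- The knot represented by a diagram. -/
def Diagram.knot (D : Diagram) : Knot := Quot.mk _ D

/-- The crossingless diagram. -/
def Diagram.circle : Diagram where
  word := []
  isGaussCode := ⟨List.nodup_nil, fun _ h => absurd h List.not_mem_nil⟩
  isPlanar := Or.inl rfl

/-- The unknot. -/
def unknot : Knot := Diagram.circle.knot

/-! ### Bridge index -/

/-- The number of bridges. The diagram is broken at its under-passages, so a maximal unbroken arc
starts right after an under-passage and ends at the next one; it contains an overcrossing
iff the passage right after its start is an over-passage. A bridge is counted through the
under-passage from which it starts. -/
def Diagram.bridgeNumber (D : Diagram) : ℕ :=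
  D.word.countP fun x => !x.isOver && (D.word.formPerm x).isOver

open Classical in
/-- The bridge index: `1` for the unknot, and the minimum bridge number over all diagrams of the knot
otherwise. -/
noncomputable def bridgeIndex (K : Knot) : ℕ :=
  if K = unknot then 1 else sInf {n | ∃ D : Diagram, D.knot = K ∧ D.bridgeNumber = n}

/-! ### Danceability index -/

/-- The rule at the crossings. -/
inductive Rule
  | overFirst
  | underFirst

/-- The passage that has to be danced first at a crossing. -/
def Rule.first : Rule → Letter → Prop
  | .overFirst, x => x.isOver = true
  | .underFirst, x => x.isOver = false

/-- An `n`-dance configuration. The `n ≥ 1` initial points cut the diagram into the paths of the `n`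
dancers, each from one initial point to the next; a path is recorded by the passages on it, in order
(it is empty if two consecutive initial points are not separated by a crossing).
The dancers can choose their speeds, so that `t x`, the time of the passage `x`, is only
required to increase along each path, and to follow the rule at each crossing. -/
def Diagram.HasDance (D : Diagram) (r : Rule) (n : ℕ) : Prop :=
  ∃ paths : List (List Letter), paths.length = n ∧ 1 ≤ n ∧ paths.flatten.IsRotated D.word ∧
    ∃ t : Letter → ℝ, (∀ p ∈ paths, p.Pairwise fun x y => t x < t y) ∧
      ∀ x ∈ D.word, r.first x → t x < t x.other

/-- The danceability number of an oriented diagram. -/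
noncomputable def Diagram.danceNumber (D : Diagram) (r : Rule) : ℕ := sInf {n | D.HasDance r n}

/-- The minimum danceability number over all diagrams of the knot, with any orientation. -/
noncomputable def danceIndex (r : Rule) (K : Knot) : ℕ :=
  sInf {n | ∃ D : Diagram, D.knot = K ∧ D.danceNumber r = n}

/-- The dance-over index. -/
noncomputable def danceOverIndex (K : Knot) : ℕ := danceIndex .overFirst K

/-- The dance-under index. -/
noncomputable def danceUnderIndex (K : Knot) : ℕ := danceIndex .underFirst K

end Danceability

namespace Danceability

/-! ### Elementary properties of Gauss codes -/

/-! A path on which all over-passages precede all under-passages is the common ground of the two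
indices. If a diagram with `b ≥ 1` bridges is cut where each bridge begins, its `b` pieces have this
form, and the dancers can pass all over-passages before any under-passage. Conversely, if `n` paths
of this form make up a diagram, a bridge can begin only at the head of a path, so there are at most
`n` bridges. These are `exists_hasDance_le_bridgeNumber` and `bridgeNumber_le_of_overUnder`.

The substance is to turn the paths of any dance-over configuration into this form without changing
the knot or the number of paths (`exists_over_under_paths`). Crossings are processed in the order of
the times of their over-passages; `E` is the set still to be processed. Let `D` be the earliest
over-passage in `E`. By the dance rule every passage before `D` on its path belongs to a processed
crossing, so `D` is preceded by a block of over-passages and then a block of under-passages. It is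
slid back over these under-passages one at a time.

In one slide (`exists_slide`) the over-passage at `d` moves past the under-passage at `c` just
before it. A second Reidemeister move pushes the over-strand of `c` along the edge from `c` to `d`
and across the under-strand of `d`; a third move on the resulting triangle exchanges `c` and `d`.
The two new crossings have their over-passages beside that of `c` and their under-passages beside
that of `d`. They count as processed, and they do not lengthen the block of under-passages before
`D`, so the procedure ends.

The intermediate codes must be planar, which is proved by counting faces: the second move adds two
(`card_face_of_finger`), the third preserves their number (`card_face_le_of_triangle`, applied to
the move and its inverse). The dance-under index reduces to the dance-over index by reversing both
orientation and time. -/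

theorem Letter.other_other (x : Letter) : x.other.other = x := by
  cases x; simp [Letter.other]

theorem IsGaussCode.nodup {w : List Letter} (h : IsGaussCode w) : w.Nodup :=
  List.Nodup.of_map _ h.1

theorem IsGaussCode.eq_of_mem {w : List Letter} (h : IsGaussCode w) {x y : Letter} (hx : x ∈ w)
    (hy : y ∈ w) (hc : x.crossing = y.crossing) (ho : x.isOver = y.isOver) : x = y :=
  List.inj_on_of_nodup_map h.1 hx hy (by simp [hc, ho])

theorem IsGaussCode.perm {w v : List Letter} (h : IsGaussCode w) (p : w.Perm v) :
    IsGaussCode v :=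
  ⟨(p.map _).nodup_iff.1 h.1, fun x hx => p.mem_iff.1 (h.2 x (p.mem_iff.2 hx))⟩

/-! ### Faces -/

theorem Dart.flip_mem {w : List Letter} {d : Dart} : (Dart.flip w d).1 ∈ w ↔ d.1 ∈ w := by
  unfold Dart.flip
  split_ifs
  · exact List.formPerm_mem_iff_mem
  · have := @List.formPerm_mem_iff_mem _ _ w (w.formPerm.symm d.1)
    simp only [Equiv.apply_symm_apply] at this
    exact this.symm

theorem Dart.flip_flip (w : List Letter) (d : Dart) : Dart.flip w (Dart.flip w d) = d := by
  obtain ⟨x, e⟩ := d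
  rcases Int.units_eq_one_or e with rfl | rfl <;> simp [Dart.flip]

theorem Dart.turn_mem {w : List Letter} (hw : IsGaussCode w) {d : Dart} (h : d.1 ∈ w) :
    (Dart.turn d).1 ∈ w := hw.2 _ h

theorem Dart.turn_over (n : ℕ) (s e : ℤˣ) :
    Dart.turn (⟨n, true, s⟩, e) = (⟨n, false, s⟩, s * e) := by
  simp [Dart.turn, Letter.other]

theorem Dart.turn_under (n : ℕ) (s e : ℤˣ) :
    Dart.turn (⟨n, false, s⟩, e) = (⟨n, true, s⟩, -s * e) := by
  simp [Dart.turn, Letter.other]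

instance finite_face (w : List Letter) : Finite (Face w) := by
  have : Finite {x : Letter // x ∈ w} := inferInstance
  have : Finite {d : Dart // d.1 ∈ w} :=
    Finite.of_injective
      (fun d => ((⟨d.1.1, d.2⟩, d.1.2) : {x : Letter // x ∈ w} × ℤˣ)) (by
        rintro ⟨⟨x, e⟩, h⟩ ⟨⟨y, f⟩, k⟩ hh
        simpa using hh)
  exact Quot.finite _

open Classical in
/-- The face on the right of a dart; a junk value if the dart does not belong to `w`. -/
noncomputable def faceOf (w : List Letter) [Nonempty (Face w)] (d : Dart) : Face w :=
  if h : d.1 ∈ w then Quot.mk _ ⟨d, h⟩ else Classical.arbitrary _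

/-- The face on the right of a dart. -/
def Face.mk (w : List Letter) (d : Dart) (h : d.1 ∈ w) : Face w := Quot.mk _ ⟨d, h⟩

theorem faceOf_eq_mk {w : List Letter} [Nonempty (Face w)] {d : Dart} (h : d.1 ∈ w) :
    faceOf w d = Face.mk w d h := dif_pos h

theorem nonempty_face {w : List Letter} {x : Letter} (h : x ∈ w) : Nonempty (Face w) :=
  ⟨Quot.mk _ ⟨(x, 1), h⟩⟩

theorem faceOf_next {w : List Letter} [Nonempty (Face w)] (hw : IsGaussCode w) {d : Dart}
    (h : d.1 ∈ w) : faceOf w (Dart.turn (Dart.flip w d)) = faceOf w d := by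
  have h' := Dart.turn_mem hw (Dart.flip_mem.2 h)
  rw [faceOf_eq_mk h', faceOf_eq_mk h]
  exact (Quot.sound (r := fun d e : {d : Dart // d.1 ∈ w} => e.1 = Dart.turn (Dart.flip w d.1))
    (a := ⟨d, h⟩) (b := ⟨_, h'⟩) rfl).symm

/-- As `flip` is an involution, the face relation becomes one between `turn d` and `flip w d`. It
then involves no composite, and all later face computations use it in this form. -/
theorem faceOf_turn {w : List Letter} [Nonempty (Face w)] (hw : IsGaussCode w) {d : Dart}
    (h : d.1 ∈ w) : faceOf w (Dart.turn d) = faceOf w (Dart.flip w d) := by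
  have := faceOf_next hw (Dart.flip_mem.2 h)
  rwa [Dart.flip_flip] at this

theorem exists_faceOf {w : List Letter} [Nonempty (Face w)] (F : Face w) :
    ∃ d : Dart, d.1 ∈ w ∧ faceOf w d = F := by
  induction F using Quot.ind with
  | mk d => exact ⟨d.1, d.2, faceOf_eq_mk d.2⟩

/-- A function on darts that is constant on the faces is a function on faces. -/
theorem exists_lift_face {Z : Type*} {w : List Letter} [Nonempty (Face w)] (g : Dart → Z)
    (hg : ∀ d : Dart, d.1 ∈ w → g (Dart.turn d) = g (Dart.flip w d)) :
    ∃ G : Face w → Z, ∀ d : Dart, d.1 ∈ w → G (faceOf w d) = g d := by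
  refine ⟨Quot.lift (fun d => g d.1) ?_, ?_⟩
  · rintro ⟨d, hd⟩ ⟨e, he⟩ h
    have := hg _ (Dart.flip_mem.2 hd)
    rw [Dart.flip_flip] at this
    simp only at h ⊢
    rw [h, this]
  · intro d hd
    rw [faceOf_eq_mk hd]
    rfl

/-- The map `f` descends to a surjection of faces. It need not commute with `turn` and `flip`, only
respect the faces they define, which leaves room to redirect darts near a local move. -/
theorem card_face_le {w v : List Letter} [Nonempty (Face w)] [Nonempty (Face v)]
    (f : Dart → Dart)
    (hf : ∀ d : Dart, d.1 ∈ w → faceOf v (f (Dart.turn d)) = faceOf v (f (Dart.flip w d)))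
    (hs : ∀ e : Dart, e.1 ∈ v → ∃ d : Dart, d.1 ∈ w ∧ faceOf v (f d) = faceOf v e) :
    Nat.card (Face v) ≤ Nat.card (Face w) := by
  obtain ⟨G, hG⟩ := exists_lift_face (fun d => faceOf v (f d)) hf
  refine Nat.card_le_card_of_surjective G fun F => ?_
  obtain ⟨e, he, rfl⟩ := exists_faceOf F
  obtain ⟨d, hd, h⟩ := hs e he
  exact ⟨faceOf w d, by rw [hG d hd, h]⟩

/-- A map of darts that commutes with `flip` and `turn` does not increase the number of faces. -/
theorem card_face_le_of_commute {w v : List Letter} (hv : IsGaussCode v)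
    (f : Dart → Dart) (hfi : Function.Surjective f) (hm : ∀ d : Dart, (f d).1 ∈ v ↔ d.1 ∈ w)
    (hflip : ∀ d : Dart, d.1 ∈ w → Dart.flip v (f d) = f (Dart.flip w d))
    (hturn : ∀ d : Dart, Dart.turn (f d) = f (Dart.turn d)) (hne : w ≠ []) :
    Nat.card (Face v) ≤ Nat.card (Face w) := by
  obtain ⟨x, hx⟩ := List.exists_mem_of_ne_nil w hne
  have := nonempty_face hx
  have := nonempty_face ((hm (x, 1)).2 hx)
  refine card_face_le f (fun d hd => ?_) (fun e he => ?_)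
  · rw [← hturn, faceOf_turn hv ((hm d).2 hd), hflip d hd]
  · obtain ⟨d, rfl⟩ := hfi e
    exact ⟨d, (hm d).1 he, rfl⟩

/-! ### Planarity under rotation and reversal -/

theorem IsPlanar.of_card {w v : List Letter} (h : IsPlanar w) (hne : w ≠ [])
    (hp : (v.countP fun x => x.isOver) = w.countP fun x => x.isOver) (hl : v.length = w.length)
    (hc : Nat.card (Face v) = Nat.card (Face w)) : IsPlanar v := by
  rcases h with h | h
  · exact absurd h hne
  · exact Or.inr (by rw [hp, hc, hl, h])

theorem IsPlanar.isRotated {w v : List Letter} (hw : IsGaussCode w) (h : IsPlanar w)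
    (hr : w ~r v) : IsPlanar v := by
  by_cases hne : w = []
  · subst hne
    rw [List.isRotated_nil_iff'] at hr
    exact Or.inl hr.symm
  have hv := hw.perm hr.perm
  have hf : w.formPerm = v.formPerm := List.formPerm_eq_of_isRotated hw.nodup hr
  have hflip : ∀ d, Dart.flip v d = Dart.flip w d := fun d => by simp [Dart.flip, hf]
  have hvne : v ≠ [] := by
    rintro rfl
    exact hne (List.isRotated_nil_iff.1 hr)
  refine h.of_card hne (hr.perm.symm.countP_eq _) hr.perm.length_eq.symm (le_antisymm ?_ ?_)
  · exact card_face_le_of_commute hv id Function.surjective_id (fun d => hr.perm.mem_iff.symm)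
      (fun d _ => hflip d) (fun _ => rfl) hne
  · exact card_face_le_of_commute hw id Function.surjective_id (fun d => hr.perm.mem_iff)
      (fun d _ => (hflip d).symm) (fun _ => rfl) hvne

/-- Reversal inverts `formPerm`, so changing the sign of every dart carries one `flip` to the other;
`turn` commutes with this sign change because the direction enters it as a factor. -/
theorem IsPlanar.reverse {w : List Letter} (hw : IsGaussCode w) (h : IsPlanar w) :
    IsPlanar w.reverse := by
  by_cases hne : w = []
  · subst hne
    exact Or.inl rfl
  have hp : w.Perm w.reverse := (List.reverse_perm w).symm
  have hv := hw.perm hp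
  have hflip : ∀ d : Dart, Dart.flip w.reverse (d.1, -d.2) =
      ((Dart.flip w d).1, -(Dart.flip w d).2) := by
    rintro ⟨x, e⟩
    rcases Int.units_eq_one_or e with rfl | rfl <;> simp [Dart.flip, List.formPerm_reverse]
    rfl
  have hflip' : ∀ d : Dart, Dart.flip w (d.1, -d.2) =
      ((Dart.flip w.reverse d).1, -(Dart.flip w.reverse d).2) := by
    intro d
    have := hflip (d.1, -d.2)
    simp only [neg_neg, Prod.mk.eta] at this
    rw [this]
    simp
  have hs : Function.Surjective fun d : Dart => ((d.1, -d.2) : Dart) :=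
    fun d => ⟨(d.1, -d.2), by simp⟩
  refine h.of_card hne (hp.symm.countP_eq _) hp.length_eq.symm (le_antisymm ?_ ?_)
  · exact card_face_le_of_commute hv _ hs (fun d => hp.mem_iff.symm)
      (fun d _ => hflip d) (fun _ => by simp [Dart.turn]) hne
  · exact card_face_le_of_commute hw _ hs (fun d => hp.mem_iff)
      (fun d _ => hflip' d) (fun _ => by simp [Dart.turn]) (by simpa using hne)

/-! ### Inserting letters -/

/-- Rotation brings the place of insertion to the end of the list, where the cycle acquires one
transposition. -/
theorem formPerm_insert_after {s t : List Letter} {x y : Letter}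
    (h : (s ++ x :: y :: t).Nodup) :
    (s ++ x :: y :: t).formPerm = (s ++ x :: t).formPerm * Equiv.swap x y := by
  have h' : (s ++ x :: t).Nodup :=
    h.sublist (List.Sublist.append_left ((List.sublist_cons_self y t).cons_cons x) s)
  have h1 : (s ++ x :: t) ~r (t ++ s ++ [x]) := by
    simpa using List.isRotated_append (l := s ++ [x]) (l' := t)
  have h2 : (s ++ x :: y :: t) ~r (t ++ s ++ [x, y]) := by
    simpa using List.isRotated_append (l := s ++ [x, y]) (l' := t)
  rw [List.formPerm_eq_of_isRotated h' h1, List.formPerm_eq_of_isRotated h h2,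
    List.formPerm_append_pair]

theorem formPerm_insert_before {s t : List Letter} {x y : Letter}
    (h : (s ++ y :: x :: t).Nodup) :
    (s ++ y :: x :: t).formPerm = Equiv.swap x y * (s ++ x :: t).formPerm := by
  have h' : (s ++ x :: t).Nodup :=
    h.sublist (List.Sublist.append_left (List.sublist_cons_self y _) s)
  have h1 : (s ++ x :: t) ~r (x :: (t ++ s)) := by
    simpa using List.isRotated_append (l := s) (l' := x :: t)
  have h2 : (s ++ y :: x :: t) ~r (y :: x :: (t ++ s)) := by
    simpa using List.isRotated_append (l := s) (l' := y :: x :: t)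
  rw [List.formPerm_eq_of_isRotated h' h1, List.formPerm_eq_of_isRotated h h2,
    List.formPerm_cons_cons, Equiv.swap_comm]

/-- The letters of `l` in this order if `g = 1`, and in the opposite order if `g = -1`. -/
def directed (g : ℤˣ) (l : List Letter) : List Letter := if g = 1 then l else l.reverse

/-- The darts of a word without the letter `y`, as darts of the word in which `y` is inserted next
to `x` in the direction `g`. -/
def Dart.push (x y : Letter) (g : ℤˣ) (d : Dart) : Dart := if d = (x, g) then (y, g) else d

/-- The effect on the edges of inserting the letter `y` next to `x` in the direction `g`. -/
theorem flip_insert {s t : List Letter} {x y : Letter} {g : ℤˣ} {w v : List Letter}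
    (hw : w = s ++ x :: t) (hv : v = s ++ directed g [x, y] ++ t) (h : v.Nodup) :
    Dart.flip v (x, g) = (y, -g) ∧ Dart.flip v (y, -g) = (x, g) ∧
      ∀ d : Dart, d.1 ∈ w → Dart.flip v (d.push x y g) = (Dart.flip w d).push x y g := by
  subst hw
  have hy : y ∉ s ++ x :: t := by
    have : v.Perm (y :: (s ++ x :: t)) := by
      subst hv
      rcases Int.units_eq_one_or g with rfl | rfl
      · simpa [directed] using List.perm_middle (l₁ := s ++ [x]) (a := y) (l₂ := t)
      · simp [directed]
    exact (List.nodup_cons.1 (this.nodup_iff.1 h)).1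
  have hfix : (s ++ x :: t).formPerm y = y := List.formPerm_apply_of_notMem hy
  have hfix' : (s ++ x :: t).formPerm.symm y = y := by rw [Equiv.symm_apply_eq, hfix]
  have hxy : x ≠ y := by rintro rfl; simp at hy
  rcases Int.units_eq_one_or g with rfl | rfl
  · have hN : v.formPerm = (s ++ x :: t).formPerm * Equiv.swap x y := by
      subst hv
      simpa [directed] using formPerm_insert_after (by simpa [directed] using h)
    have h1 : Dart.flip v (x, 1) = (y, -1) := by simp [Dart.flip, hN, hfix]
    have h2 : Dart.flip v (y, -1) = (x, 1) := by rw [← h1, Dart.flip_flip]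
    refine ⟨h1, h2, ?_⟩
    generalize s ++ x :: t = w at *
    rintro ⟨z, e⟩ hz
    have hzy : z ≠ y := by rintro rfl; exact hy hz
    have hzy' : w.formPerm.symm z ≠ y := fun hh => hzy (by
      rw [Equiv.symm_apply_eq, hfix] at hh; exact hh)
    rcases Int.units_eq_one_or e with rfl | rfl
    · by_cases hzx : z = x
      · subst hzx; simp [Dart.push, Dart.flip, hN]
      · simp [Dart.push, Dart.flip, hN, hzx, Equiv.swap_apply_of_ne_of_ne hzx hzy]
    · by_cases hzx : w.formPerm.symm z = x
      · simp [Dart.push, Dart.flip, hN, hzx, Equiv.Perm.mul_def]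
      · simp [Dart.push, Dart.flip, hN, hzx, Equiv.Perm.mul_def,
          Equiv.swap_apply_of_ne_of_ne hzx hzy']
  · have hN : v.formPerm = Equiv.swap x y * (s ++ x :: t).formPerm := by
      subst hv
      simpa [directed] using formPerm_insert_before (by simpa [directed] using h)
    have h2 : Dart.flip v (y, 1) = (x, -1) := by simp [Dart.flip, hN, hfix]
    have h1 : Dart.flip v (x, -1) = (y, 1) := by rw [← h2, Dart.flip_flip]
    refine ⟨by simpa using h1, by simpa using h2, ?_⟩
    generalize s ++ x :: t = w at *
    rintro ⟨z, e⟩ hz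
    have hzy : z ≠ y := by rintro rfl; exact hy hz
    have hzy' : w.formPerm z ≠ y := fun hh => hzy (w.formPerm.injective (hh.trans hfix.symm))
    rcases Int.units_eq_one_or e with rfl | rfl
    · by_cases hzx : w.formPerm z = x
      · simp [Dart.push, Dart.flip, hN, hzx]
      · simp [Dart.push, Dart.flip, hN, hzx, Equiv.swap_apply_of_ne_of_ne hzx hzy']
    · by_cases hzx : z = x
      · subst hzx; simp [Dart.push, Dart.flip, hN, Equiv.Perm.mul_def]
      · simp [Dart.push, Dart.flip, hN, hzx, Equiv.Perm.mul_def,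
          Equiv.swap_apply_of_ne_of_ne hzx hzy]

/-- The effect on the edges of inserting the letters `y`, `z` next to `x` in the direction `g`. -/
theorem flip_insert_two {s t : List Letter} {x y z : Letter} {g : ℤˣ} {w v : List Letter}
    (hw : w = s ++ x :: t) (hv : v = s ++ directed g [x, y, z] ++ t) (h : v.Nodup) :
    Dart.flip v (x, g) = (y, -g) ∧ Dart.flip v (y, g) = (z, -g) ∧
      ∀ d : Dart, d.1 ∈ w → Dart.flip v (d.push x z g) = (Dart.flip w d).push x z g := by
  -- The letters are inserted one at a time: `y` next to `x`, then `z` next to `y`.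
  have hn : (s ++ directed g [x, y] ++ t).Nodup := by
    refine h.sublist ?_
    subst hv
    refine ((List.Sublist.refl s).append ?_).append (List.Sublist.refl t)
    unfold directed
    split_ifs
    · simp
    · simp
  obtain ⟨h1, h1', h1''⟩ := flip_insert hw rfl hn
  have hx : x ∈ w := by simp [hw]
  have key : ∃ s' t', s ++ directed g [x, y] ++ t = s' ++ y :: t' ∧
      v = s' ++ directed g [y, z] ++ t' := by
    rcases Int.units_eq_one_or g with rfl | rfl
    · exact ⟨s ++ [x], t, by simp [directed], by simp [directed, hv]⟩
    · exact ⟨s, x :: t, by simp [directed], by simp [directed, hv]⟩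
  obtain ⟨s', t', e1, e2⟩ := key
  obtain ⟨h2, h2', h2''⟩ := flip_insert e1 e2 h
  have hsub : ∀ u ∈ w, u ∈ s ++ directed g [x, y] ++ t := by
    intro u hu
    subst hw
    unfold directed
    split_ifs <;> simp at hu ⊢ <;> tauto
  have hxy : x ≠ y := by
    rintro rfl
    unfold directed at hn
    split_ifs at hn <;> simp [List.nodup_append] at hn
  have hyw : y ∉ w := by
    intro hy
    subst hw
    rcases Int.units_eq_one_or g with rfl | rfl
    · rw [List.mem_append, List.mem_cons] at hy
      simp [directed, List.nodup_append] at hn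
      rcases hy with hy | hy | hy
      · exact (hn.2.2 y hy).2.1 rfl
      · exact hxy hy.symm
      · exact hn.2.1.2.1 hy
    · rw [List.mem_append, List.mem_cons] at hy
      simp [directed, List.nodup_append] at hn
      rcases hy with hy | hy | hy
      · exact (hn.2.2 y hy).1 rfl
      · exact hxy hy.symm
      · exact hn.2.1.1.2 hy
  refine ⟨?_, h2, fun d hd => ?_⟩
  · have := h2'' (x, g) (hsub _ hx)
    rw [h1] at this
    simpa [Dart.push, hxy] using this
  · have h3 := h2'' (d.push x y g) (by
      have := (Dart.flip_mem (w := s ++ directed g [x, y] ++ t) (d := d.push x y g)).1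
      apply this
      rw [h1'' d hd]
      unfold Dart.push
      split_ifs
      · simp only [directed]; split_ifs <;> simp
      · exact hsub _ (Dart.flip_mem.2 hd))
    rw [h1'' d hd] at h3
    -- Pushing from `x` to `y` and then from `y` to `z` is pushing from `x` to `z`, since no dart of
    -- `w` starts at `y`.
    have hp : ∀ d : Dart, d.1 ∈ w → (d.push x y g).push y z g = d.push x z g := by
      rintro ⟨u, e⟩ hu
      have : u ≠ y := by rintro rfl; exact hyw hu
      by_cases hux : u = x ∧ e = g
      · simp [Dart.push, hux]
      · simp [Dart.push, hux, this]
    rwa [hp d hd, hp _ (Dart.flip_mem.2 hd)] at h3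

/-! ### Counting faces under a second and a third Reidemeister move -/

theorem Dart.turn_injective : Function.Injective Dart.turn := by
  rintro ⟨⟨n, o, s⟩, e⟩ ⟨⟨m, o', s'⟩, e'⟩ h
  simp only [Dart.turn, Letter.other, Prod.mk.injEq, Letter.mk.injEq] at h
  obtain ⟨⟨h1, h2, h3⟩, h4⟩ := h
  rw [Bool.not_inj_iff] at h2
  subst h1 h2 h3
  split_ifs at h4 <;> simpa using h4

set_option maxHeartbeats 800000 in
set_option linter.unusedSimpArgs false in
/-- The number of faces increases by two if a finger of one edge is pushed over another edge of the
same face. The darts `C`, `E`, `E'`, `D`, `F` are at the corners of this face, and the two new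
crossings have the darts `A₀, A₁, P₀, P₁` and `B₀, B₁, Q₀, Q₁`. -/
theorem card_face_of_finger {w v : List Letter} (hw : IsGaussCode w) (hv : IsGaussCode v)
    {C E E' D F A₀ A₁ P₀ P₁ B₀ B₁ Q₀ Q₁ : Dart}
    (hd : [C, E, E', D, F, A₀, A₁, P₀, P₁, B₀, B₁, Q₀, Q₁].Nodup)
    (hold : ∀ x ∈ [C, E, E', D, F], x.1 ∈ w)
    (hnew : ∀ x ∈ [A₀, A₁, P₀, P₁, B₀, B₁, Q₀, Q₁], x.1 ∉ w ∧ x.1 ∈ v)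
    (hsub : ∀ x ∈ w, x ∈ v)
    (hcov : ∀ x : Dart, x.1 ∈ v → x.1 ∈ w ∨ x ∈ [A₀, A₁, P₀, P₁, B₀, B₁, Q₀, Q₁])
    (tC : C.turn = E) (tE' : E'.turn = F) (tF : F.turn = D)
    (tA₀ : A₀.turn = P₁) (tA₁ : A₁.turn = P₀) (tP₀ : P₀.turn = A₀) (tP₁ : P₁.turn = A₁)
    (tB₀ : B₀.turn = Q₀) (tB₁ : B₁.turn = Q₁) (tQ₀ : Q₀.turn = B₁) (tQ₁ : Q₁.turn = B₀)
    (fE : Dart.flip w E = E') (fC : Dart.flip v C = A₀) (fA : Dart.flip v A₁ = B₀)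
    (fF : Dart.flip v F = P₀) (fP : Dart.flip v P₁ = Q₀)
    (hflip : ∀ x : Dart, x.1 ∈ w → Dart.flip v (if x = C then B₁ else if x = F then Q₁ else x) =
      if Dart.flip w x = C then B₁ else if Dart.flip w x = F then Q₁ else Dart.flip w x) :
    Nat.card (Face v) = Nat.card (Face w) + 2 := by
  have hCw := hold C (by simp)
  have hEw := hold E (by simp)
  have hE'w := hold E' (by simp)
  have hDw := hold D (by simp)
  have hFw := hold F (by simp)
  have hne : ∀ x : Dart, x.1 ∈ w → x ≠ A₀ ∧ x ≠ A₁ ∧ x ≠ P₀ ∧ x ≠ P₁ ∧ x ≠ B₀ ∧ x ≠ B₁ ∧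
      x ≠ Q₀ ∧ x ≠ Q₁ := by
    intro x hx
    refine ⟨?_, ?_, ?_, ?_, ?_, ?_, ?_, ?_⟩ <;>
    · rintro rfl
      exact (hnew x (by simp)).1 hx
  have _ : Nonempty (Face w) := nonempty_face hCw
  have _ : Nonempty (Face v) := nonempty_face (hsub _ hCw)
  have fE' : Dart.flip w E' = E := by rw [← fE, Dart.flip_flip]
  have fA₀ : Dart.flip v A₀ = C := by rw [← fC, Dart.flip_flip]
  have fB₀ : Dart.flip v B₀ = A₁ := by rw [← fA, Dart.flip_flip]
  have fP₀ : Dart.flip v P₀ = F := by rw [← fF, Dart.flip_flip]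
  have fQ₀ : Dart.flip v Q₀ = P₁ := by rw [← fP, Dart.flip_flip]
  -- The reversed list supplies every inequality between the darts in the opposite direction.
  have hr := List.nodup_reverse.2 hd
  simp only [List.reverse_cons, List.reverse_nil, List.nil_append, List.cons_append] at hr
  simp only [List.nodup_cons, List.mem_cons, List.not_mem_nil, not_or, or_false, not_false_eq_true,
    List.nodup_nil, and_true] at hd hr
  simp only [List.mem_cons, List.not_mem_nil, or_false, forall_eq_or_imp, forall_eq] at hnew
  -- faces of the new code
  have vt : ∀ x : Dart, x.1 ∈ v → faceOf v x.turn = faceOf v (Dart.flip v x) :=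
    fun x hx => faceOf_turn hv hx
  have vA₀ := vt A₀ hnew.1.2
  have vA₁ := vt A₁ hnew.2.1.2
  have vP₀ := vt P₀ hnew.2.2.1.2
  have vP₁ := vt P₁ hnew.2.2.2.1.2
  have vB₀ := vt B₀ hnew.2.2.2.2.1.2
  have vQ₀ := vt Q₀ hnew.2.2.2.2.2.2.1.2
  have vC := vt C (hsub _ hCw)
  have vF := vt F (hsub _ hFw)
  rw [tA₀, fA₀] at vA₀
  rw [tA₁, fA] at vA₁
  rw [tP₀, fP₀] at vP₀
  rw [tP₁, fP] at vP₁
  rw [tB₀, fB₀] at vB₀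
  rw [tQ₀, fQ₀] at vQ₀
  rw [tC, fC] at vC
  rw [tF, fF] at vF
  have wE' := faceOf_turn hw hE'w
  rw [tE', fE'] at wE'
  -- `θ` follows the ends of the old edges: those at `C` and `F` are now at `B₁` and `Q₁`. The two
  -- extra values of `G` are the new triangle, with corners `A₀`, `E`, `F`, and the new bigon, with
  -- corners `A₁`, `Q₀`. What remains of the old face of `E` and `F` is seen from `Q₁`, which
  -- explains the exception in `H`.
  let θ : Dart → Dart := fun x => if x = C then B₁ else if x = F then Q₁ else x
  let ρ : Dart → Dart := fun x => if x = P₁ ∨ x = B₁ then C else if x = Q₁ then F else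
    if x = B₀ ∨ x = P₀ then D else x
  let G : Dart → Option (Option (Face w)) := fun x =>
    if x = A₀ ∨ x = E ∨ x = F then none else if x = A₁ ∨ x = Q₀ then some none else
      some (some (faceOf w (ρ x)))
  let H : Dart → Face v := fun x => if x = E ∨ x = F then faceOf v Q₁ else faceOf v x
  have hGθ : ∀ x : Dart, x.1 ∈ w → x ≠ E → G (θ x) = some (some (faceOf w x)) := by
    intro x hx hxE
    have := hne x hx
    by_cases h1 : x = C
    · subst h1; simp [G, θ, ρ, hd, hr]
    · by_cases h2 : x = F
      · subst h2; simp [G, θ, ρ, hd, hr]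
      · simp [G, θ, ρ, h1, h2, hxE, this]
  have hGt : ∀ x : Dart, x.1 ∈ w → x ≠ E' → G (θ x).turn = some (some (faceOf w x.turn)) := by
    intro x hx hxE
    have htw : x.turn.1 ∈ w := Dart.turn_mem hw hx
    have := hne _ htw
    by_cases h1 : x = C
    · subst h1; simp [G, θ, ρ, hd, hr, tB₁, tC, wE']
    · by_cases h2 : x = F
      · subst h2; simp [G, θ, ρ, hd, hr, tQ₁, tF]
      · have h3 : x.turn ≠ E := fun h => h1 (Dart.turn_injective (h.trans tC.symm))
        have h4 : x.turn ≠ F := fun h => hxE (Dart.turn_injective (h.trans tE'.symm))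
        simp [G, θ, ρ, h1, h2, h3, h4, this]
  have hθ : ∀ x : Dart, x ≠ C → x ≠ F → θ x = x := fun x h1 h2 => by simp [θ, h1, h2]
  have hflip' : ∀ x : Dart, x.1 ∈ w → Dart.flip v (θ x) = θ (Dart.flip w x) := hflip
  have hfE : ∀ x : Dart, x ≠ E' → Dart.flip w x ≠ E := fun x h h' => h (by
    rw [← fE, ← h', Dart.flip_flip])
  obtain ⟨Φ, hΦ⟩ := exists_lift_face (w := v) G (by
    intro x hx
    -- Darts in the image of `θ` are compared with the old edges; the others are the eight ends of
    -- the four short edges created by the finger.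
    by_cases hxw : ∃ z : Dart, z.1 ∈ w ∧ x = θ z
    · obtain ⟨z, hz, rfl⟩ := hxw
      rw [hflip' z hz]
      by_cases hzE : z = E'
      · subst hzE
        rw [hθ z (Ne.symm hd.1.2.1) hd.2.2.1.2.1, tE', fE',
          hθ E (Ne.symm hd.1.1) hd.2.1.2.2.1]
        simp [G, hd, hr]
      · rw [hGt z hz hzE, hGθ _ (Dart.flip_mem.2 hz) (hfE z hzE), faceOf_turn hw hz]
    · have hx' : x = C ∨ x = F ∨ x = A₀ ∨ x = A₁ ∨ x = P₀ ∨ x = P₁ ∨ x = B₀ ∨ x = Q₀ := by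
        rcases hcov x hx with h | h
        · by_contra hcon
          exact hxw ⟨x, h, (hθ x (fun h => hcon (Or.inl h))
            (fun h => hcon (Or.inr (Or.inl h)))).symm⟩
        · simp only [List.mem_cons, List.not_mem_nil, or_false] at h
          have h1 : x ≠ B₁ := fun h => hxw ⟨C, hCw, by simp [θ, h]⟩
          have h2 : x ≠ Q₁ := fun h => hxw ⟨F, hFw, by simp [θ, h, hr]⟩
          clear * - h h1 h2
          tauto
      rcases hx' with rfl | rfl | rfl | rfl | rfl | rfl | rfl | rfl
      · rw [tC, fC]; simp [G, hd, hr]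
      · rw [tF, fF]; simp [G, ρ, hd, hr]
      · rw [tA₀, fA₀]; simp [G, ρ, hd, hr]
      · rw [tA₁, fA]; simp [G, ρ, hd, hr]
      · rw [tP₀, fP₀]; simp [G, hd, hr]
      · rw [tP₁, fP]; simp [G, hd, hr]
      · rw [tB₀, fB₀]; simp [G, hd, hr]
      · rw [tQ₀, fQ₀]; simp [G, ρ, hd, hr])
  have hHθ : ∀ x : Dart, x.1 ∈ w → x ≠ E → H x = faceOf v (θ x) := by
    intro x hx hxE
    by_cases h1 : x = C
    · subst h1
      simp [H, θ, hd, vA₀, vQ₀]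
    · by_cases h2 : x = F
      · subst h2; simp [H, θ, h1]
      · simp [H, θ, h1, h2, hxE]
  have hHt : ∀ x : Dart, x.1 ∈ w → x ≠ E' → H x.turn = faceOf v (θ x).turn := by
    intro x hx hxE
    by_cases h1 : x = C
    · subst h1; simp [H, θ, tC, tB₁]
    · by_cases h2 : x = F
      · subst h2; simp [H, θ, hd, hr, tF, tQ₁, vF, vA₁]
      · have h3 : x.turn ≠ E := fun h => h1 (Dart.turn_injective (h.trans tC.symm))
        have h4 : x.turn ≠ F := fun h => hxE (Dart.turn_injective (h.trans tE'.symm))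
        simp [H, hθ x h1 h2, h3, h4]
  have hθv : ∀ x : Dart, x.1 ∈ w → (θ x).1 ∈ v := by
    intro x hx
    simp only [θ]
    split_ifs
    · exact hnew.2.2.2.2.2.1.2
    · exact hnew.2.2.2.2.2.2.2.2
    · exact hsub _ hx
  obtain ⟨Ψ, hΨ⟩ := exists_lift_face (w := w) H (by
    intro x hx
    by_cases hxE : x = E'
    · subst hxE; rw [tE', fE']; simp [H]
    · rw [hHt x hx hxE, hHθ _ (Dart.flip_mem.2 hx) (hfE x hxE), ← hflip' x hx,
        faceOf_turn hv (hθv x hx)])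
  have hl : ∀ X : Face w, Φ (Ψ X) = some (some X) := by
    intro X
    obtain ⟨x, hx, rfl⟩ := exists_faceOf X
    rw [hΨ x hx]
    by_cases hxE : x = E
    · subst hxE
      have := hGθ F hFw (Ne.symm hd.2.1.2.2.1)
      simp only [H, true_or, if_true]
      rw [hΦ _ hnew.2.2.2.2.2.2.2.2, ← wE', ← this]
      simp [θ, hr]
    · rw [hHθ x hx hxE, hΦ _ (hθv x hx), hGθ x hx hxE]
  have e : Option (Option (Face w)) ≃ Face v :=
    { toFun := fun o => o.elim (faceOf v A₀) fun o => o.elim (faceOf v A₁) Ψ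
      invFun := Φ
      left_inv := by
        rintro (_ | _ | X)
        · simp only [Option.elim]
          rw [hΦ _ hnew.1.2]; simp [G, hd, hr]
        · simp only [Option.elim]
          rw [hΦ _ hnew.2.1.2]; simp [G, hd, hr]
        · exact hl X
      right_inv := by
        intro X
        obtain ⟨x, hx, rfl⟩ := exists_faceOf X
        rw [hΦ x hx]
        by_cases h0 : x = A₀ ∨ x = E ∨ x = F
        · rcases h0 with rfl | rfl | rfl
          · simp [G, hd, hr]
          · simp [G, vC]
          · simp [G, vP₀]
        · by_cases h1 : x = A₁ ∨ x = Q₀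
          · rcases h1 with rfl | rfl
            · simp [G, hd, hr]
            · simp [G, hd, hr, vB₀]
          · have hρ : (ρ x).1 ∈ w ∧ H (ρ x) = faceOf v x := by
              rcases hcov x hx with h | h
              · have : ρ x = x := by simp [ρ, hne x h]
                rw [this]
                exact ⟨h, by simp only [H]; rw [if_neg fun h' => h0 (Or.inr h')]⟩
              · simp only [List.mem_cons, List.not_mem_nil, or_false] at h
                have h' : x = P₁ ∨ x = B₁ ∨ x = Q₁ ∨ x = B₀ ∨ x = P₀ := by
                  clear * - h h0 h1
                  tauto
                rcases h' with rfl | rfl | rfl | rfl | rfl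
                · simp [ρ, H, hd, hCw, vA₀]
                · simp [ρ, H, hd, hCw, vQ₀, vA₀]
                · simp [ρ, H, hd, hr, hFw]
                · simp [ρ, H, hd, hr, hDw, vF, vA₁]
                · simp [ρ, H, hd, hr, hDw, vF]
            simp only [G, if_neg h0, if_neg h1, Option.elim]
            rw [hΨ _ hρ.1, hρ.2] }
  rw [← Nat.card_congr e, Finite.card_option, Finite.card_option]

set_option maxHeartbeats 800000 in
set_option linter.unusedSimpArgs false in
/-- A third Reidemeister move does not increase the number of faces. The three strands pass the
crossings of the triangle in the letters of `A`, `B`, in those of `a`, `C`, and in those of `b`,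
`c`; the darts with index `1` point to the second letter. -/
theorem card_face_le_of_triangle {w v : List Letter} (hv : IsGaussCode v)
    (hmem : ∀ x, x ∈ v ↔ x ∈ w) (ψ : Letter → Letter) (hψ : Function.Involutive ψ)
    (hψm : ∀ x, ψ x ∈ w ↔ x ∈ w)
    (hflip : ∀ d : Dart, d.1 ∈ w → Dart.flip v (ψ d.1, d.2) =
      (ψ (Dart.flip w d).1, (Dart.flip w d).2))
    {A₀ A₁ B₀ B₁ C₀ C₁ a₀ a₁ b₀ b₁ c₀ c₁ : Dart}
    (hd : [A₀, A₁, B₀, B₁, C₀, C₁, a₀, a₁, b₀, b₁, c₀, c₁].Nodup)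
    (hm : ∀ x ∈ [A₀, A₁, B₀, B₁, C₀, C₁, a₀, a₁, b₀, b₁, c₀, c₁], x.1 ∈ w)
    (pA₀ : B₀ = (ψ A₀.1, A₀.2)) (pA₁ : B₁ = (ψ A₁.1, A₁.2))
    (pC₀ : a₀ = (ψ C₀.1, C₀.2)) (pC₁ : a₁ = (ψ C₁.1, C₁.2))
    (pb₀ : c₀ = (ψ b₀.1, b₀.2)) (pb₁ : c₁ = (ψ b₁.1, b₁.2))
    (hother : ∀ x : Dart, x ∉ [A₀, A₁, B₀, B₁, C₀, C₁, a₀, a₁, b₀, b₁, c₀, c₁] → ψ x.1 = x.1)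
    (tA₀ : A₀.turn = a₀) (tA₁ : A₁.turn = a₁) (tB₀ : B₀.turn = b₀) (tB₁ : B₁.turn = b₁)
    (tC₀ : C₀.turn = c₀) (tC₁ : C₁.turn = c₁) (ta₀ : a₀.turn = A₁) (ta₁ : a₁.turn = A₀)
    (tb₀ : b₀.turn = B₁) (tb₁ : b₁.turn = B₀) (tc₀ : c₀.turn = C₁) (tc₁ : c₁.turn = C₀)
    (fA : Dart.flip w A₁ = B₀) (fa : Dart.flip w a₁ = C₀) (fb : Dart.flip w b₁ = c₀) :
    Nat.card (Face v) ≤ Nat.card (Face w) := by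
  let P : Dart → Dart := fun d => (ψ d.1, d.2)
  have hP : ∀ d, P (P d) = d := fun d => by simp [P, hψ d.1]
  replace pA₀ : P A₀ = B₀ := pA₀.symm
  replace pA₁ : P A₁ = B₁ := pA₁.symm
  replace pC₀ : P C₀ = a₀ := pC₀.symm
  replace pC₁ : P C₁ = a₁ := pC₁.symm
  replace pb₀ : P b₀ = c₀ := pb₀.symm
  replace pb₁ : P b₁ = c₁ := pb₁.symm
  have pB₀ : P B₀ = A₀ := by rw [← pA₀, hP]
  have pB₁ : P B₁ = A₁ := by rw [← pA₁, hP]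
  have pa₀ : P a₀ = C₀ := by rw [← pC₀, hP]
  have pa₁ : P a₁ = C₁ := by rw [← pC₁, hP]
  have pc₀ : P c₀ = b₀ := by rw [← pb₀, hP]
  have pc₁ : P c₁ = b₁ := by rw [← pb₁, hP]
  have fB : Dart.flip w B₀ = A₁ := by rw [← fA, Dart.flip_flip]
  have fC : Dart.flip w C₀ = a₁ := by rw [← fa, Dart.flip_flip]
  have fc : Dart.flip w c₀ = b₁ := by rw [← fb, Dart.flip_flip]
  have hPv : ∀ x : Dart, x.1 ∈ w → (P x).1 ∈ v := fun x hx => (hmem _).2 ((hψm _).2 hx)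
  have _ : Nonempty (Face w) := nonempty_face (hm A₀ (by simp))
  have _ : Nonempty (Face v) := nonempty_face (hPv A₀ (hm A₀ (by simp)))
  have hr := List.nodup_reverse.2 hd
  simp only [List.reverse_cons, List.reverse_nil, List.nil_append, List.cons_append] at hr
  have vt : ∀ x : Dart, x.1 ∈ w → faceOf v (P x).turn = faceOf v (P (Dart.flip w x)) := by
    intro x hx
    rw [faceOf_turn hv (hPv x hx)]
    exact congrArg _ (hflip x hx)
  have hP' : ∀ x y : Dart, x.turn = y → x ∉ [A₀, A₁, B₀, B₁, C₀, C₁, a₀, a₁, b₀, b₁, c₀, c₁] →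
      P x = x ∧ P y = y ∧ y ∉ [A₀, A₁, B₀, B₁, C₀, C₁, a₀, a₁, b₀, b₁, c₀, c₁] := by
    intro x y hxy hx
    have hy : y ∉ [A₀, A₁, B₀, B₁, C₀, C₁, a₀, a₁, b₀, b₁, c₀, c₁] := by
      intro hy
      apply hx
      simp only [List.mem_cons, List.not_mem_nil, or_false] at hy
      rcases hy with rfl | rfl | rfl | rfl | rfl | rfl | rfl | rfl | rfl | rfl | rfl | rfl
      · rw [Dart.turn_injective (hxy.trans ta₁.symm)]; simp
      · rw [Dart.turn_injective (hxy.trans ta₀.symm)]; simp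
      · rw [Dart.turn_injective (hxy.trans tb₁.symm)]; simp
      · rw [Dart.turn_injective (hxy.trans tb₀.symm)]; simp
      · rw [Dart.turn_injective (hxy.trans tc₁.symm)]; simp
      · rw [Dart.turn_injective (hxy.trans tc₀.symm)]; simp
      · rw [Dart.turn_injective (hxy.trans tA₀.symm)]; simp
      · rw [Dart.turn_injective (hxy.trans tA₁.symm)]; simp
      · rw [Dart.turn_injective (hxy.trans tB₀.symm)]; simp
      · rw [Dart.turn_injective (hxy.trans tB₁.symm)]; simp
      · rw [Dart.turn_injective (hxy.trans tC₀.symm)]; simp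
      · rw [Dart.turn_injective (hxy.trans tC₁.symm)]; simp
    exact ⟨by simp [P, hother x hx], by simp [P, hother y hy], hy⟩
  have vA₀ := vt A₀ (hm _ (by simp))
  have vA₁ := vt A₁ (hm _ (by simp))
  have vB₀ := vt B₀ (hm _ (by simp))
  have vB₁ := vt B₁ (hm _ (by simp))
  have vC₀ := vt C₀ (hm _ (by simp))
  have vC₁ := vt C₁ (hm _ (by simp))
  have va₀ := vt a₀ (hm _ (by simp))
  have va₁ := vt a₁ (hm _ (by simp))
  have vb₀ := vt b₀ (hm _ (by simp))
  have vb₁ := vt b₁ (hm _ (by simp))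
  have vc₀ := vt c₀ (hm _ (by simp))
  have vc₁ := vt c₁ (hm _ (by simp))
  rw [pA₀, tB₀] at vA₀
  rw [pA₁, tB₁, fA, pB₀] at vA₁
  rw [pB₀, tA₀, fB, pA₁] at vB₀
  rw [pB₁, tA₁] at vB₁
  rw [pC₀, ta₀, fC, pa₁] at vC₀
  rw [pC₁, ta₁] at vC₁
  rw [pa₀, tC₀] at va₀
  rw [pa₁, tC₁, fa, pC₀] at va₁
  rw [pb₀, tc₀] at vb₀
  rw [pb₁, tc₁, fb, pc₀] at vb₁
  rw [pc₀, tb₀, fc, pb₁] at vc₀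
  rw [pc₁, tb₁] at vc₁
  -- `P` carries darts along with their strands and is right except at the six ends of the edges of
  -- the triangle. The corners `B₀`, `a₁`, `c₀` of the old triangle go to the corner `B₁` of the new
  -- one. The values at `A₁`, `C₀`, `b₁` are forced: in `w` these darts share a face with `b₀`,
  -- `A₀`, `C₁`, which `P` sends to `c₀`, `B₀`, `a₁`.
  let f : Dart → Dart := fun x => if x = A₁ then c₀ else if x = C₀ then B₀ else if x = b₁ then a₁
    else if x = B₀ ∨ x = a₁ ∨ x = c₀ then B₁ else P x
  have hf : ∀ x, x ∉ [A₁, C₀, b₁, B₀, a₁, c₀] → f x = P x := by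
    intro x hx
    simp only [List.mem_cons, List.not_mem_nil, or_false, not_or] at hx
    simp [f, hx]
  have hfl : ∀ x, x ∉ [A₁, C₀, b₁, B₀, a₁, c₀] → f (Dart.flip w x) = P (Dart.flip w x) := by
    intro x hx
    apply hf
    simp only [List.mem_cons, List.not_mem_nil, or_false, not_or] at hx ⊢
    obtain ⟨h1, h2, h3, h4, h5, h6⟩ := hx
    refine ⟨fun h => h4 ?_, fun h => h5 ?_, fun h => h6 ?_, fun h => h1 ?_, fun h => h2 ?_,
      fun h => h3 ?_⟩
    · rw [← Dart.flip_flip w x, h, fA]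
    · rw [← Dart.flip_flip w x, h, fC]
    · rw [← Dart.flip_flip w x, h, fb]
    · rw [← Dart.flip_flip w x, h, fB]
    · rw [← Dart.flip_flip w x, h, fa]
    · rw [← Dart.flip_flip w x, h, fc]
  simp only [List.nodup_cons, List.mem_cons, List.not_mem_nil, not_or, or_false, not_false_eq_true,
    List.nodup_nil, and_true] at hd hr
  refine card_face_le f (fun x hx => ?_) (fun e he => ?_)
  · by_cases h : x ∈ [A₀, A₁, B₀, B₁, C₀, C₁, a₀, a₁, b₀, b₁, c₀, c₁]
    · simp only [List.mem_cons, List.not_mem_nil, or_false] at h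
      rcases h with rfl | rfl | rfl | rfl | rfl | rfl | rfl | rfl | rfl | rfl | rfl | rfl
      · rw [hfl _ (by simp [hd, hr]), tA₀, ← vA₀]
        simp [f, hd, hr, pa₀, vb₁]
      · rw [tA₁, fA]; simp [f, hd, hr]
      · rw [tB₀, fB]; simp [f, hd, hr]; rw [pb₀]
      · rw [hfl _ (by simp [hd, hr]), tB₁, ← vB₁]
        simp [f, hd, hr]
      · rw [tC₀, fC]; simp [f, hd, hr]
      · rw [hfl _ (by simp [hd, hr]), tC₁, ← vC₁]
        simp [f, hd, hr]; rw [pc₁, vA₁]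
      · rw [hfl _ (by simp [hd, hr]), ta₀, ← va₀]
        simp [f, hd, hr]
      · rw [ta₁, fa]; simp [f, hd, hr]; rw [pA₀]
      · rw [hfl _ (by simp [hd, hr]), tb₀, ← vb₀]
        simp [f, hd, hr]; rw [pB₁, vC₀]
      · rw [tb₁, fb]; simp [f, hd, hr]
      · rw [tc₀, fc]; simp [f, hd, hr]; rw [pC₁]
      · rw [hfl _ (by simp [hd, hr]), tc₁, ← vc₁]
        simp [f, hd, hr]
    · obtain ⟨h1, h2, h3⟩ := hP' x _ rfl h
      have h4 := vt x hx
      rw [h1] at h4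
      simp only [List.mem_cons, List.not_mem_nil, or_false, not_or] at h h3
      rw [hfl x (by simp [h]), hf _ (by simp [h3]), h2, h4]
  · have he' : e.1 ∈ w := (hmem _).1 he
    by_cases h : P e ∈ [A₁, C₀, b₁, B₀, a₁, c₀]
    · have h0 : e = P (P e) := (hP e).symm
      simp only [List.mem_cons, List.not_mem_nil, or_false] at h
      rcases h with h | h | h | h | h | h <;> rw [h0, h]
      · exact ⟨B₀, hm _ (by simp), by simp [f, hd, hr, pA₁]⟩
      · exact ⟨B₀, hm _ (by simp), by simp [f, hd, hr, pC₀]; rw [vB₀]⟩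
      · exact ⟨B₀, hm _ (by simp), by simp [f, hd, hr, pb₁]; rw [vc₀]⟩
      · exact ⟨c₁, hm _ (by simp), by simp [f, hd, hr, pc₁, pB₀]; rw [vA₁]⟩
      · exact ⟨B₁, hm _ (by simp), by simp [f, hd, hr, pB₁, pa₁]; rw [vC₀]⟩
      · exact ⟨a₀, hm _ (by simp), by simp [f, hd, hr, pa₀, pc₀]; rw [vb₁]⟩
    · exact ⟨P e, (hψm _).2 he', by rw [hf _ h, hP]⟩

/-! ### Pushing a finger -/

theorem directed_perm (g : ℤˣ) (l : List Letter) : (directed g l).Perm l := by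
  unfold directed
  split_ifs
  · exact List.Perm.refl l
  · exact l.reverse_perm

theorem IsGaussCode.cons_cons {w : List Letter} (hw : IsGaussCode w) {a : ℕ} {s : ℤˣ}
    (ha : ∀ z ∈ w, z.crossing ≠ a) :
    IsGaussCode (⟨a, true, s⟩ :: ⟨a, false, s⟩ :: w) := by
  have h' : ∀ o, (a, o) ∉ w.map fun x => (x.crossing, x.isOver) := by
    intro o h
    obtain ⟨z, hz, e⟩ := List.mem_map.1 h
    exact ha z hz (congrArg Prod.fst e)
  constructor
  · rw [List.map_cons, List.map_cons, List.nodup_cons, List.nodup_cons]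
    exact ⟨by simpa using h' true, h' false, hw.1⟩
  · intro x hx
    simp only [List.mem_cons] at hx
    rcases hx with rfl | rfl | hx
    · simp [Letter.other]
    · simp [Letter.other]
    · simp [hw.2 x hx]

/-- The letters after a finger of the over-strand at the crossing `c` has been pushed, along the
strand that leaves `c` as its under-strand and enters `d` as its over-strand, across the under-strand
at `d`. -/
theorem perm_finger (c d a b : ℕ) (p q : ℤˣ) (l₁ l₂ u t : List Letter)
    (h₁ : l₁.Perm [⟨c, true, p⟩, ⟨a, true, p * q⟩, ⟨b, true, -(p * q)⟩])
    (h₂ : l₂.Perm [⟨d, false, q⟩, ⟨a, false, p * q⟩, ⟨b, false, -(p * q)⟩]) :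
    (l₁ ++ u ++ l₂ ++ t).Perm
      (⟨a, true, p * q⟩ :: ⟨a, false, p * q⟩ :: ⟨b, true, -(p * q)⟩ :: ⟨b, false, -(p * q)⟩ ::
        (⟨c, true, p⟩ :: u ++ ⟨d, false, q⟩ :: t)) := by
  refine (((h₁.append (List.Perm.refl u)).append h₂).append (List.Perm.refl t)).trans ?_
  rw [List.perm_iff_count]
  intro x
  simp only [List.count_append, List.count_cons, List.count_nil]
  omega

theorem isGaussCode_of_perm_finger {c d a b : ℕ} {p q : ℤˣ} {u t v : List Letter}
    (hw : IsGaussCode (⟨c, true, p⟩ :: u ++ ⟨d, false, q⟩ :: t))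
    (ha : ∀ z ∈ ⟨c, true, p⟩ :: u ++ ⟨d, false, q⟩ :: t, z.crossing ≠ a)
    (hb : ∀ z ∈ ⟨c, true, p⟩ :: u ++ ⟨d, false, q⟩ :: t, z.crossing ≠ b) (hab : a ≠ b)
    (h : v.Perm
      (⟨a, true, p * q⟩ :: ⟨a, false, p * q⟩ :: ⟨b, true, -(p * q)⟩ :: ⟨b, false, -(p * q)⟩ ::
        (⟨c, true, p⟩ :: u ++ ⟨d, false, q⟩ :: t))) : IsGaussCode v := by
  refine IsGaussCode.perm ?_ h.symm
  refine (hw.cons_cons hb).cons_cons ?_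
  intro z hz
  rw [List.mem_cons, List.mem_cons] at hz
  rcases hz with rfl | rfl | hz
  · exact hab.symm
  · exact hab.symm
  · exact ha z hz

set_option maxHeartbeats 1000000 in
/-- Pushing a finger preserves planarity and makes `c`, `a`, `d` the corners of a triangle. -/
theorem isPlanar_finger {c d a b : ℕ} {p q : ℤˣ} {u t w v : List Letter}
    (hw' : w = ⟨c, true, p⟩ :: u ++ ⟨d, false, q⟩ :: t)
    (hv' : v = directed p [⟨c, true, p⟩, ⟨a, true, p * q⟩, ⟨b, true, -(p * q)⟩] ++ u ++
      directed (-q) [⟨d, false, q⟩, ⟨a, false, p * q⟩, ⟨b, false, -(p * q)⟩] ++ t)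
    (hw : IsGaussCode w) (hpl : IsPlanar w)
    (ha : ∀ z ∈ w, z.crossing ≠ a) (hb : ∀ z ∈ w, z.crossing ≠ b) (hab : a ≠ b) (hcd : c ≠ d)
    (hnext : w.formPerm ⟨c, false, p⟩ = ⟨d, true, q⟩) :
    IsPlanar v ∧ Dart.flip v (⟨c, true, p⟩, p) = (⟨a, true, p * q⟩, -p) ∧
      Dart.flip v (⟨c, false, p⟩, 1) = (⟨d, true, q⟩, -1) ∧
      Dart.flip v (⟨a, false, p * q⟩, q) = (⟨d, false, q⟩, -q) := by
  have hperm : v.Perm (⟨a, true, p * q⟩ :: ⟨a, false, p * q⟩ :: ⟨b, true, -(p * q)⟩ ::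
      ⟨b, false, -(p * q)⟩ :: w) := by
    rw [hv', hw']
    exact perm_finger c d a b p q _ _ u t (directed_perm _ _) (directed_perm _ _)
  have hv : IsGaussCode v := by
    subst hw'
    exact isGaussCode_of_perm_finger hw ha hb hab hperm
  have hCw : (⟨c, true, p⟩ : Letter) ∈ w := by simp [hw']
  have hD'w : (⟨d, false, q⟩ : Letter) ∈ w := by simp [hw']
  have hC'w : (⟨c, false, p⟩ : Letter) ∈ w := hw.2 _ hCw
  have hDw : (⟨d, true, q⟩ : Letter) ∈ w := hw.2 _ hD'w
  have hca : c ≠ a := ha _ hCw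
  have hcb : c ≠ b := hb _ hCw
  have hda : d ≠ a := ha _ hDw
  have hdb : d ≠ b := hb _ hDw
  have hmem : ∀ z, z ∈ v ↔ z = ⟨a, true, p * q⟩ ∨ z = ⟨a, false, p * q⟩ ∨ z = ⟨b, true, -(p * q)⟩ ∨
      z = ⟨b, false, -(p * q)⟩ ∨ z ∈ w := by
    intro z
    rw [hperm.mem_iff]
    simp only [List.mem_cons]
  -- An intermediate word with only the over-passages of the finger inserted, so that the insertion
  -- of two letters can be applied to each strand separately.
  set w₁ : List Letter := [] ++ directed p [⟨c, true, p⟩, ⟨a, true, p * q⟩, ⟨b, true, -(p * q)⟩] ++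
    (u ++ ⟨d, false, q⟩ :: t) with hw₁
  have hw₁' : w₁ = (directed p [⟨c, true, p⟩, ⟨a, true, p * q⟩, ⟨b, true, -(p * q)⟩] ++ u) ++
    ⟨d, false, q⟩ :: t := by simp [hw₁]
  have hn₁ : w₁.Nodup := by
    refine hv.nodup.sublist ?_
    rw [hw₁', hv', List.append_assoc _ (directed (-q) _) t]
    refine List.Sublist.append_left ?_ _
    exact List.Sublist.append (l₁ := [_]) (by unfold directed; split_ifs <;> simp)
      (List.Sublist.refl t)
  have hmem₁ : ∀ z, z ∈ w₁ ↔ z = ⟨a, true, p * q⟩ ∨ z = ⟨b, true, -(p * q)⟩ ∨ z ∈ w := by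
    intro z
    rw [hw₁, hw', List.mem_append, List.mem_append, (directed_perm _ _).mem_iff]
    simp only [List.mem_cons, List.mem_append, List.not_mem_nil, false_or, or_false]
    tauto
  obtain ⟨f1, f2, f3⟩ := flip_insert_two (s := []) (by simpa using hw') hw₁ hn₁
  obtain ⟨g1, g2, g3⟩ := flip_insert_two hw₁' hv' hv.nodup
  have hne : p ≠ -p := by rcases Int.units_eq_one_or p with rfl | rfl <;> decide
  have hne' : q ≠ -q := by rcases Int.units_eq_one_or q with rfl | rfl <;> decide
  have hno : ∀ z : Letter, ∀ e, z.crossing = a ∨ z.crossing = b ∨ z.isOver = true →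
      Dart.push ⟨d, false, q⟩ ⟨b, false, -(p * q)⟩ (-q) (z, e) = (z, e) := by
    intro z e h
    rw [Dart.push, if_neg]
    rintro h'
    have : z = ⟨d, false, q⟩ := congrArg Prod.fst h'
    subst this
    rcases h with h | h | h
    · exact hda h
    · exact hdb h
    · exact Bool.noConfusion h
  have k1 : Dart.flip v (⟨c, true, p⟩, p) = (⟨a, true, p * q⟩, -p) := by
    have := g3 (⟨c, true, p⟩, p) ((hmem₁ _).2 (Or.inr (Or.inr hCw)))
    rwa [hno _ _ (Or.inr (Or.inr rfl)), f1, hno _ _ (Or.inl rfl)] at this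
  have k2 : Dart.flip w (⟨c, false, p⟩, 1) = (⟨d, true, q⟩, -1) := by simp [Dart.flip, hnext]
  have k3 : Dart.flip v (⟨d, false, q⟩, -q) = (⟨a, false, p * q⟩, q) := by simpa using g1
  have k4 : ∀ x : Dart, x.1 ∈ w → Dart.flip v (if x = (⟨c, true, p⟩, p) then
      (⟨b, true, -(p * q)⟩, p) else if x = (⟨d, false, q⟩, -q) then (⟨b, false, -(p * q)⟩, -q) else x)
      = if Dart.flip w x = (⟨c, true, p⟩, p) then (⟨b, true, -(p * q)⟩, p) else
        if Dart.flip w x = (⟨d, false, q⟩, -q) then (⟨b, false, -(p * q)⟩, -q)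
        else Dart.flip w x := by
    have hθ : ∀ x : Dart, (x.push ⟨c, true, p⟩ ⟨b, true, -(p * q)⟩ p).push
        ⟨d, false, q⟩ ⟨b, false, -(p * q)⟩ (-q) =
        if x = (⟨c, true, p⟩, p) then (⟨b, true, -(p * q)⟩, p) else
          if x = (⟨d, false, q⟩, -q) then (⟨b, false, -(p * q)⟩, -q) else x := by
      intro x
      by_cases h : x = (⟨c, true, p⟩, p)
      · simp [h, Dart.push]
      · simp [h, Dart.push]
    intro x hx
    rw [← hθ, ← hθ, ← f3 x hx]
    apply g3
    rw [hmem₁, Dart.push]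
    split_ifs
    · simp
    · exact Or.inr (Or.inr hx)
  refine ⟨?_, k1, by simpa [k2, hcd, hcd.symm] using k4 (⟨c, false, p⟩, 1) hC'w,
    by rw [← k3, Dart.flip_flip]⟩
  have hcard := card_face_of_finger (w := w) (v := v) hw hv
    (C := (⟨c, true, p⟩, p)) (E := (⟨c, false, p⟩, 1)) (E' := (⟨d, true, q⟩, -1))
    (D := (⟨d, true, q⟩, 1)) (F := (⟨d, false, q⟩, -q))
    (A₀ := (⟨a, true, p * q⟩, -p)) (A₁ := (⟨a, true, p * q⟩, p))
    (P₀ := (⟨a, false, p * q⟩, q)) (P₁ := (⟨a, false, p * q⟩, -q))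
    (B₀ := (⟨b, true, -(p * q)⟩, -p)) (B₁ := (⟨b, true, -(p * q)⟩, p))
    (Q₀ := (⟨b, false, -(p * q)⟩, q)) (Q₁ := (⟨b, false, -(p * q)⟩, -q))
    (by simp [hcd, hca, hcb, hda, hdb, hab, hne, hne', hne.symm, hne'.symm])
    (by simp [hCw, hC'w, hDw, hD'w])
    (by
      have h1 : ∀ o s, (⟨a, o, s⟩ : Letter) ∉ w := fun o s h => ha _ h rfl
      have h2 : ∀ o s, (⟨b, o, s⟩ : Letter) ∉ w := fun o s h => hb _ h rfl
      simp [h1, h2, hmem])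
    (fun x hx => by simp [hmem, hx])
    (by
      rintro ⟨x, e⟩ hx
      have hp' : e = p ∨ e = -p := by
        rcases Int.units_eq_one_or p with rfl | rfl <;> rcases Int.units_eq_one_or e with rfl | rfl
          <;> simp
      have hq' : e = q ∨ e = -q := by
        rcases Int.units_eq_one_or q with rfl | rfl <;> rcases Int.units_eq_one_or e with rfl | rfl
          <;> simp
      simp only [hmem] at hx
      rcases hx with rfl | rfl | rfl | rfl | hx
      · rcases hp' with h | h <;> simp [h]
      · rcases hq' with h | h <;> simp [h]
      · rcases hp' with h | h <;> simp [h]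
      · rcases hq' with h | h <;> simp [h]
      · exact Or.inl hx)
    (by simp [Dart.turn_over]) (by simp [Dart.turn_over]) (by simp [Dart.turn_under])
    (by simp [Dart.turn_over, mul_right_comm p q]) (by simp [Dart.turn_over, mul_right_comm p q])
    (by simp [Dart.turn_under, mul_assoc]) (by simp [Dart.turn_under, mul_assoc])
    (by simp [Dart.turn_over, mul_right_comm p q]) (by simp [Dart.turn_over, mul_right_comm p q])
    (by simp [Dart.turn_under, mul_assoc]) (by simp [Dart.turn_under, mul_assoc])
    k2 k1
    (by
      have := g3 (⟨a, true, p * q⟩, p) ((hmem₁ _).2 (Or.inl rfl))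
      rwa [hno _ _ (Or.inl rfl), f2, hno _ _ (Or.inr (Or.inl rfl))] at this)
    k3 (by simpa using g2) k4
  rcases hpl with hpl | hpl
  · rw [hpl] at hCw
    simp at hCw
  -- Two more crossings, four more edges and two more faces leave the Euler characteristic
  -- unchanged.
  · refine Or.inr ?_
    rw [hcard, hperm.countP_eq, hperm.length_eq]
    simp only [List.countP_cons, List.length_cons, if_true]
    simp
    omega

/-! ### The third Reidemeister move as a permutation of letters -/

theorem formPerm_map (π : Equiv.Perm Letter) :
    ∀ l : List Letter, (l.map π).formPerm = π * l.formPerm * π⁻¹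
  | [] => by simp
  | [x] => by simp
  | x :: y :: l => by
    have h := formPerm_map π (y :: l)
    rw [List.map_cons] at h
    rw [List.map_cons, List.map_cons, List.formPerm_cons_cons, List.formPerm_cons_cons, h]
    simp only [← mul_assoc, Equiv.mul_swap_eq_swap_mul]

theorem flip_map (π : Equiv.Perm Letter) (l : List Letter) (d : Dart) :
    Dart.flip (l.map π) (π d.1, d.2) = (π (Dart.flip l d).1, (Dart.flip l d).2) := by
  have h : (l.map π).formPerm.symm = π * l.formPerm⁻¹ * π⁻¹ := by
    change (l.map π).formPerm⁻¹ = _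
    rw [formPerm_map]
    group
  unfold Dart.flip
  split_ifs
  · simp [formPerm_map]
  · simp [h]

/-- Exchange the letters of the crossings of a triangle along each of its three strands. -/
def triangleSwap (C A E D P F : Letter) : Equiv.Perm Letter :=
  Equiv.swap C A * Equiv.swap E D * Equiv.swap P F

set_option linter.unusedSimpArgs false in
theorem triangleSwap_spec {c d a : ℕ} {p q : ℤˣ} (hcd : c ≠ d) (hca : c ≠ a) (hda : d ≠ a)
    {π : Equiv.Perm Letter}
    (hπ : π = triangleSwap ⟨c, true, p⟩ ⟨a, true, p * q⟩ ⟨c, false, p⟩ ⟨d, true, q⟩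
      ⟨a, false, p * q⟩ ⟨d, false, q⟩) :
    π ⟨c, true, p⟩ = ⟨a, true, p * q⟩ ∧ π ⟨a, true, p * q⟩ = ⟨c, true, p⟩ ∧
      π ⟨c, false, p⟩ = ⟨d, true, q⟩ ∧ π ⟨d, true, q⟩ = ⟨c, false, p⟩ ∧
      π ⟨a, false, p * q⟩ = ⟨d, false, q⟩ ∧ π ⟨d, false, q⟩ = ⟨a, false, p * q⟩ ∧
      ∀ x : Letter, x ∉ ([⟨c, true, p⟩, ⟨a, true, p * q⟩, ⟨c, false, p⟩, ⟨d, true, q⟩,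
        ⟨a, false, p * q⟩, ⟨d, false, q⟩] : List Letter) → π x = x := by
  refine ⟨?_, ?_, ?_, ?_, ?_, ?_, fun x hx => ?_⟩
  iterate 6
    simp [hπ, triangleSwap, Equiv.swap_apply_def, hcd, hca, hda, hcd.symm, hca.symm, hda.symm]
  simp only [List.mem_cons, List.not_mem_nil, or_false, not_or] at hx
  simp [hπ, triangleSwap, Equiv.swap_apply_def, hx]

/-- The move reverses the direction of each edge of the triangle, which is the sign `ε`. With both
signs allowed, the one inequality applies to the move and to its inverse. -/
theorem card_face_triangleSwap_le {c d a : ℕ} {p q ε : ℤˣ} {w v : List Letter}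
    (hw : IsGaussCode w) (hv : IsGaussCode v)
    (hmem : ∀ x, x ∈ v ↔ x ∈ w) (hcd : c ≠ d) (hca : c ≠ a) (hda : d ≠ a)
    {π : Equiv.Perm Letter}
    (hπ : π = triangleSwap ⟨c, true, p⟩ ⟨a, true, p * q⟩ ⟨c, false, p⟩ ⟨d, true, q⟩
      ⟨a, false, p * q⟩ ⟨d, false, q⟩)
    (hflip : ∀ x : Dart, Dart.flip v (π x.1, x.2) = (π (Dart.flip w x).1, (Dart.flip w x).2))
    (hcw : (⟨c, true, p⟩ : Letter) ∈ w) (hdw : (⟨d, true, q⟩ : Letter) ∈ w)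
    (haw : (⟨a, true, p * q⟩ : Letter) ∈ w)
    (fA : Dart.flip w (⟨c, true, p⟩, p * ε) = (⟨a, true, p * q⟩, -(p * ε)))
    (fa : Dart.flip w (⟨c, false, p⟩, ε) = (⟨d, true, q⟩, -ε))
    (fb : Dart.flip w (⟨a, false, p * q⟩, q * ε) = (⟨d, false, q⟩, -(q * ε))) :
    Nat.card (Face v) ≤ Nat.card (Face w) := by
  have hcw' : (⟨c, false, p⟩ : Letter) ∈ w := hw.2 _ hcw
  have hdw' : (⟨d, false, q⟩ : Letter) ∈ w := hw.2 _ hdw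
  have haw' : (⟨a, false, p * q⟩ : Letter) ∈ w := hw.2 _ haw
  have hne : ∀ e : ℤˣ, e ≠ -e := fun e => by
    rcases Int.units_eq_one_or e with rfl | rfl <;> decide
  have hne' : ∀ e : ℤˣ, -e ≠ e := fun e => (hne e).symm
  obtain ⟨p₁, p₁', p₂, p₂', p₃, p₃', hfix⟩ := triangleSwap_spec hcd hca hda hπ
  have hall : ∀ x : Letter, (x ∈ ([⟨c, true, p⟩, ⟨a, true, p * q⟩, ⟨c, false, p⟩, ⟨d, true, q⟩,
      ⟨a, false, p * q⟩, ⟨d, false, q⟩] : List Letter) ∧ π (π x) = x ∧ x ∈ w ∧ π x ∈ w) ∨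
      π x = x := by
    intro x
    by_cases hx : x ∈ ([⟨c, true, p⟩, ⟨a, true, p * q⟩, ⟨c, false, p⟩, ⟨d, true, q⟩,
      ⟨a, false, p * q⟩, ⟨d, false, q⟩] : List Letter)
    · refine Or.inl ⟨hx, ?_⟩
      simp only [List.mem_cons, List.not_mem_nil, or_false] at hx
      rcases hx with rfl | rfl | rfl | rfl | rfl | rfl <;>
        simp [p₁, p₁', p₂, p₂', p₃, p₃', hcw, hcw', hdw, hdw', haw, haw']
    · exact Or.inr (hfix x hx)
  refine card_face_le_of_triangle hv hmem π ?_ ?_ (fun x _ => hflip x)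
    (A₀ := (⟨c, true, p⟩, -(p * ε))) (A₁ := (⟨c, true, p⟩, p * ε))
    (B₀ := (⟨a, true, p * q⟩, -(p * ε))) (B₁ := (⟨a, true, p * q⟩, p * ε))
    (C₀ := (⟨d, true, q⟩, -ε)) (C₁ := (⟨d, true, q⟩, ε))
    (a₀ := (⟨c, false, p⟩, -ε)) (a₁ := (⟨c, false, p⟩, ε))
    (b₀ := (⟨a, false, p * q⟩, -(q * ε))) (b₁ := (⟨a, false, p * q⟩, q * ε))
    (c₀ := (⟨d, false, q⟩, -(q * ε))) (c₁ := (⟨d, false, q⟩, q * ε))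
    ?_ ?_ (by rw [p₁]) (by rw [p₁]) (by rw [p₂']) (by rw [p₂']) (by rw [p₃]) (by rw [p₃]) ?_
    (by simp [Dart.turn_over, ← mul_assoc]) (by simp [Dart.turn_over, ← mul_assoc])
    (by simp [Dart.turn_over, ← mul_assoc, mul_right_comm p q p])
    (by simp [Dart.turn_over, ← mul_assoc, mul_right_comm p q p])
    (by simp [Dart.turn_over]) (by simp [Dart.turn_over])
    (by simp [Dart.turn_under]) (by simp [Dart.turn_under])
    (by simp [Dart.turn_under, ← mul_assoc, mul_assoc p q q])
    (by simp [Dart.turn_under, ← mul_assoc, mul_assoc p q q])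
    (by simp [Dart.turn_under, ← mul_assoc]) (by simp [Dart.turn_under, ← mul_assoc])
    fA fa fb
  · intro x
    rcases hall x with h | h
    · exact h.2.1
    · rw [h, h]
  · intro x
    rcases hall x with h | h
    · simp [h.2.2]
    · rw [h]
  · simp [hcd, hca, hda, hcd.symm, hca.symm, hda.symm, hne, hne']
  · simp [hcw, hcw', hdw, hdw', haw, haw']
  · rintro ⟨x, e⟩ hx
    apply hfix
    have h' : ∀ r : ℤˣ, e = r ∨ e = -r := fun r => by
      rcases Int.units_eq_one_or r with rfl | rfl <;> rcases Int.units_eq_one_or e with rfl | rfl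
        <;> simp
    intro hx'
    apply hx
    simp only [List.mem_cons, List.not_mem_nil, or_false] at hx'
    rcases hx' with rfl | rfl | rfl | rfl | rfl | rfl
    · rcases h' (p * ε) with h | h <;> simp [h]
    · rcases h' (p * ε) with h | h <;> simp [h]
    · rcases h' ε with h | h <;> simp [h]
    · rcases h' ε with h | h <;> simp [h]
    · rcases h' (q * ε) with h | h <;> simp [h]
    · rcases h' (q * ε) with h | h <;> simp [h]

/-- A third Reidemeister move preserves planarity. -/
theorem isPlanar_map_triangleSwap {c d a : ℕ} {p q : ℤˣ} {w : List Letter}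
    (hw : IsGaussCode w) (hpl : IsPlanar w) (hcd : c ≠ d) (hca : c ≠ a) (hda : d ≠ a)
    {π : Equiv.Perm Letter}
    (hπ : π = triangleSwap ⟨c, true, p⟩ ⟨a, true, p * q⟩ ⟨c, false, p⟩ ⟨d, true, q⟩
      ⟨a, false, p * q⟩ ⟨d, false, q⟩) (hp : (w.map π).Perm w)
    (hcw : (⟨c, true, p⟩ : Letter) ∈ w) (hdw : (⟨d, true, q⟩ : Letter) ∈ w)
    (haw : (⟨a, true, p * q⟩ : Letter) ∈ w)
    (fA : Dart.flip w (⟨c, true, p⟩, p) = (⟨a, true, p * q⟩, -p))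
    (fa : Dart.flip w (⟨c, false, p⟩, 1) = (⟨d, true, q⟩, -1))
    (fb : Dart.flip w (⟨a, false, p * q⟩, q) = (⟨d, false, q⟩, -q)) :
    IsPlanar (w.map π) := by
  have hv : IsGaussCode (w.map π) := hw.perm hp.symm
  obtain ⟨p₁, p₁', p₂, p₂', p₃, p₃', hfix⟩ := triangleSwap_spec hcd hca hda hπ
  have hinv : ∀ x, π (π x) = x := by
    intro x
    by_cases hx : x ∈ ([⟨c, true, p⟩, ⟨a, true, p * q⟩, ⟨c, false, p⟩, ⟨d, true, q⟩,
        ⟨a, false, p * q⟩, ⟨d, false, q⟩] : List Letter)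
    · simp only [List.mem_cons, List.not_mem_nil, or_false] at hx
      rcases hx with rfl | rfl | rfl | rfl | rfl | rfl <;> simp [p₁, p₁', p₂, p₂', p₃, p₃']
    · rw [hfix x hx, hfix x hx]
  have hflip := flip_map π w
  have hflip' : ∀ x : Dart, Dart.flip w (π x.1, x.2) =
      (π (Dart.flip (w.map π) x).1, (Dart.flip (w.map π) x).2) := by
    intro x
    have h := hflip (π x.1, x.2)
    rw [hinv] at h
    rw [h, hinv]
  have hgA : Dart.flip (w.map π) (⟨c, true, p⟩, -p) = (⟨a, true, p * q⟩, p) := by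
    have h := hflip (⟨a, true, p * q⟩, -p)
    have h' : Dart.flip w (⟨a, true, p * q⟩, -p) = (⟨c, true, p⟩, p) := by rw [← fA, Dart.flip_flip]
    rw [h'] at h
    simpa [p₁', p₁] using h
  have hga : Dart.flip (w.map π) (⟨c, false, p⟩, -1) = (⟨d, true, q⟩, 1) := by
    have h := hflip (⟨d, true, q⟩, -1)
    have h' : Dart.flip w (⟨d, true, q⟩, -1) = (⟨c, false, p⟩, 1) := by rw [← fa, Dart.flip_flip]
    rw [h'] at h
    simpa [p₂', p₂] using h
  have hgb : Dart.flip (w.map π) (⟨a, false, p * q⟩, -q) = (⟨d, false, q⟩, q) := by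
    have h := hflip (⟨d, false, q⟩, -q)
    have h' : Dart.flip w (⟨d, false, q⟩, -q) = (⟨a, false, p * q⟩, q) := by rw [← fb, Dart.flip_flip]
    rw [h'] at h
    simpa [p₃', p₃] using h
  refine hpl.of_card (List.ne_nil_of_mem hcw) (hp.countP_eq _) (by simp) (le_antisymm ?_ ?_)
  · exact card_face_triangleSwap_le (ε := 1) hw hv (fun x => hp.mem_iff) hcd hca hda hπ hflip
      hcw hdw haw (by simpa using fA) fa (by simpa using fb)
  · exact card_face_triangleSwap_le (ε := -1) hv hw (fun x => hp.mem_iff.symm) hcd hca hda hπ hflip'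
      (hp.mem_iff.2 hcw) (hp.mem_iff.2 hdw) (hp.mem_iff.2 haw) (by simpa using hgA)
      (by simpa using hga) (by simpa using hgb)

/-! ### Sliding an over-passage over an under-passage -/

theorem knot_eq_of_isRotated {D E : Diagram} (h : D.word ~r E.word) : D.knot = E.knot := by
  obtain ⟨n, hn⟩ := h
  refine Quot.sound ?_
  have := Move.rotate (D.word.take (n % D.word.length)) (D.word.drop (n % D.word.length))
  rw [List.take_append_drop] at this
  rwa [← hn, List.rotate_eq_drop_append_take_mod]

/-- Diagrams represent the same knot if their codes are related by a move up to rotation. -/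
theorem knot_eq_of_move {D E : Diagram} {u v : List Letter} (hu : D.word ~r u) (hv : E.word ~r v)
    (h : Move u v) : D.knot = E.knot := by
  let D' : Diagram := ⟨u, D.isGaussCode.perm hu.perm, D.isPlanar.isRotated D.isGaussCode hu⟩
  let E' : Diagram := ⟨v, E.isGaussCode.perm hv.perm, E.isPlanar.isRotated E.isGaussCode hv⟩
  calc D.knot = D'.knot := knot_eq_of_isRotated hu
    _ = E'.knot := Quot.sound h
    _ = E.knot := (knot_eq_of_isRotated hv).symm

theorem isRotated_flatMap {l l' : List Letter} (h : l ~r l') (f : Letter → List Letter) :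
    l.flatMap f ~r l'.flatMap f := by
  obtain ⟨n, rfl⟩ := h
  rw [List.rotate_eq_drop_append_take_mod, List.flatMap_append]
  conv_lhs => rw [← List.take_append_drop (n % l.length) l, List.flatMap_append]
  exact List.isRotated_append

/-- The words before and after pushing a finger are related by a second Reidemeister move. -/
theorem move_finger (c d a b : ℕ) (p q : ℤˣ) (u t : List Letter) :
    ∃ w v, (⟨c, true, p⟩ :: u ++ ⟨d, false, q⟩ :: t) ~r w ∧
      (directed p [⟨c, true, p⟩, ⟨a, true, p * q⟩, ⟨b, true, -(p * q)⟩] ++ u ++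
      directed (-q) [⟨d, false, q⟩, ⟨a, false, p * q⟩, ⟨b, false, -(p * q)⟩] ++ t) ~r v ∧
      Move w v := by
  -- `Move.r2` has the two new over-letters at the head of the word. For `p = 1` they follow the
  -- letter of `c`, which is therefore rotated to the end.
  have h1 : ∀ x : Letter, ∀ l : List Letter, (x :: l) ~r (l ++ [x]) :=
    fun x l => ⟨1, by simp⟩
  rcases Int.units_eq_one_or p with rfl | rfl <;> rcases Int.units_eq_one_or q with rfl | rfl
  · refine ⟨_, _, h1 _ _, h1 _ _, ?_⟩
    have h := Move.r2 a b 1 (-1) u (⟨d, false, 1⟩ :: (t ++ [⟨c, true, 1⟩]))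
    simpa [ordered, directed] using h
  · refine ⟨_, _, h1 _ _, h1 _ _, ?_⟩
    have h := Move.r2 a b (-1) 1 (u ++ [⟨d, false, -1⟩]) (t ++ [⟨c, true, 1⟩])
    simpa [ordered, directed] using h
  · refine ⟨_, _, List.IsRotated.refl _, List.IsRotated.refl _, ?_⟩
    have h := Move.r2 b a 1 1 (⟨c, true, -1⟩ :: u) (⟨d, false, 1⟩ :: t)
    simpa [ordered, directed] using h
  · refine ⟨_, _, List.IsRotated.refl _, List.IsRotated.refl _, ?_⟩
    have h := Move.r2 b a (-1) (-1) (⟨c, true, -1⟩ :: u ++ [⟨d, false, -1⟩]) t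
    simpa [ordered, directed] using h

/-- The middle strand of the triangle precedes the bottom strand. -/
theorem move_triangle (c d a b : ℕ) (p q : ℤˣ) (u v t : List Letter) :
    ∃ w w',
      (directed p [⟨c, true, p⟩, ⟨a, true, p * q⟩, ⟨b, true, -(p * q)⟩] ++ u ++
        [⟨c, false, p⟩, ⟨d, true, q⟩] ++ v ++
        directed (-q) [⟨d, false, q⟩, ⟨a, false, p * q⟩, ⟨b, false, -(p * q)⟩] ++ t) ~r w ∧
      (directed p [⟨a, true, p * q⟩, ⟨c, true, p⟩, ⟨b, true, -(p * q)⟩] ++ u ++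
        [⟨d, true, q⟩, ⟨c, false, p⟩] ++ v ++
        directed (-q) [⟨a, false, p * q⟩, ⟨d, false, q⟩, ⟨b, false, -(p * q)⟩] ++ t) ~r w' ∧
      Move w w' := by
  have h1 : ∀ x : Letter, ∀ l : List Letter, (x :: l) ~r (l ++ [x]) :=
    fun x l => ⟨1, by simp⟩
  rcases Int.units_eq_one_or p with rfl | rfl <;> rcases Int.units_eq_one_or q with rfl | rfl
  · refine ⟨_, _, List.IsRotated.refl _, List.IsRotated.refl _, ?_⟩
    have h := Move.r3 c a d 1 1 1 1 (⟨b, true, -1⟩ :: u)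
      (v ++ [⟨b, false, -1⟩]) t
    simpa [ordered, directed] using h
  · refine ⟨_, _, List.IsRotated.refl _, List.IsRotated.refl _, ?_⟩
    have h := Move.r3 c a d 1 1 1 (-1) (⟨b, true, 1⟩ :: u)
      v (⟨b, false, 1⟩ :: t)
    simpa [ordered, directed] using h
  · refine ⟨_, _, h1 _ _, h1 _ _, ?_⟩
    have h := Move.r3 c a d 1 (-1) 1 1 u
      (v ++ [⟨b, false, 1⟩]) (t ++ [⟨b, true, 1⟩])
    simpa [ordered, directed] using h
  · refine ⟨_, _, h1 _ _, h1 _ _, ?_⟩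
    have h := Move.r3 c a d 1 (-1) 1 (-1) u
      v (⟨b, false, -1⟩ :: (t ++ [⟨b, true, -1⟩]))
    simpa [ordered, directed] using h

/-- The bottom strand of the triangle precedes the middle strand. -/
theorem move_triangle' (c d a b : ℕ) (p q : ℤˣ) (u v t : List Letter) :
    ∃ w w',
      (directed p [⟨c, true, p⟩, ⟨a, true, p * q⟩, ⟨b, true, -(p * q)⟩] ++ u ++
        directed (-q) [⟨d, false, q⟩, ⟨a, false, p * q⟩, ⟨b, false, -(p * q)⟩] ++ v ++
        [⟨c, false, p⟩, ⟨d, true, q⟩] ++ t) ~r w ∧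
      (directed p [⟨a, true, p * q⟩, ⟨c, true, p⟩, ⟨b, true, -(p * q)⟩] ++ u ++
        directed (-q) [⟨a, false, p * q⟩, ⟨d, false, q⟩, ⟨b, false, -(p * q)⟩] ++ v ++
        [⟨d, true, q⟩, ⟨c, false, p⟩] ++ t) ~r w' ∧
      Move w w' := by
  have h1 : ∀ x : Letter, ∀ l : List Letter, (x :: l) ~r (l ++ [x]) :=
    fun x l => ⟨1, by simp⟩
  rcases Int.units_eq_one_or p with rfl | rfl <;> rcases Int.units_eq_one_or q with rfl | rfl
  · refine ⟨_, _, List.IsRotated.refl _, List.IsRotated.refl _, ?_⟩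
    have h := Move.r3' c a d 1 1 1 1 (⟨b, true, -1⟩ :: (u ++ [⟨b, false, -1⟩]))
      v t
    simpa [ordered, directed] using h
  · refine ⟨_, _, List.IsRotated.refl _, List.IsRotated.refl _, ?_⟩
    have h := Move.r3' c a d 1 1 1 (-1) (⟨b, true, 1⟩ :: u)
      (⟨b, false, 1⟩ :: v) t
    simpa [ordered, directed] using h
  · refine ⟨_, _, h1 _ _, h1 _ _, ?_⟩
    have h := Move.r3' c a d 1 (-1) 1 1 (u ++ [⟨b, false, 1⟩])
      v (t ++ [⟨b, true, 1⟩])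
    simpa [ordered, directed] using h
  · refine ⟨_, _, h1 _ _, h1 _ _, ?_⟩
    have h := Move.r3' c a d 1 (-1) 1 (-1) u
      (⟨b, false, -1⟩ :: v) (t ++ [⟨b, true, -1⟩])
    simpa [ordered, directed] using h

/-- The letters that replace a letter when a finger is pushed. -/
def fingerSubst (c d a b : ℕ) (p q : ℤˣ) (z : Letter) : List Letter :=
  if z = ⟨c, true, p⟩ then directed p [⟨c, true, p⟩, ⟨a, true, p * q⟩, ⟨b, true, -(p * q)⟩]
  else if z = ⟨d, false, q⟩ then
    directed (-q) [⟨d, false, q⟩, ⟨a, false, p * q⟩, ⟨b, false, -(p * q)⟩]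
  else [z]

/-- The letters that replace a letter when the over-passage of `d` slides over the under-passage
of `c`. -/
def slideSubst (c d a b : ℕ) (p q : ℤˣ) (z : Letter) : List Letter :=
  if z = ⟨c, true, p⟩ then directed p [⟨a, true, p * q⟩, ⟨c, true, p⟩, ⟨b, true, -(p * q)⟩]
  else if z = ⟨d, false, q⟩ then
    directed (-q) [⟨a, false, p * q⟩, ⟨d, false, q⟩, ⟨b, false, -(p * q)⟩]
  else [z]

theorem formPerm_apply_of_append {s t : List Letter} {x y : Letter}
    (h : (s ++ x :: y :: t).Nodup) : (s ++ x :: y :: t).formPerm x = y := by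
  have hr : (s ++ x :: y :: t) ~r (x :: y :: (t ++ s)) := by
    simpa using List.isRotated_append (l := s) (l' := x :: y :: t)
  rw [List.formPerm_eq_of_isRotated h hr]
  exact List.formPerm_apply_head x y _ (hr.nodup_iff.1 h)

theorem flatMap_eq_self {f : Letter → List Letter} {l : List Letter} (h : ∀ z ∈ l, f z = [z]) :
    l.flatMap f = l := by
  rw [List.flatMap_congr h]
  simp

theorem map_directed (f : Letter → Letter) (g : ℤˣ) (l : List Letter) :
    (directed g l).map f = directed g (l.map f) := by
  unfold directed
  split_ifs <;> simp

set_option maxHeartbeats 1000000 in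
/-- An over-passage slides over the under-passage that precedes it. -/
theorem exists_slide (G : Diagram) (S : Finset ℕ) {c d : ℕ} {p q : ℤˣ} {x y : List Letter}
    (hword : G.word = x ++ ⟨c, false, p⟩ :: ⟨d, true, q⟩ :: y) (hcd : c ≠ d) :
    ∃ a b : ℕ, a ∉ S ∧ b ∉ S ∧
      ∃ E : Diagram, E.knot = G.knot ∧
        E.word = x.flatMap (slideSubst c d a b p q) ++ ⟨d, true, q⟩ :: ⟨c, false, p⟩ ::
          y.flatMap (slideSubst c d a b p q) := by
  -- The new labels avoid `S` besides the labels in use; with `S` the set of unprocessed crossings,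
  -- the new crossings count as processed.
  obtain ⟨a, ha⟩ := Infinite.exists_notMem_finset (S ∪ (G.word.map Letter.crossing).toFinset)
  obtain ⟨b, hb⟩ := Infinite.exists_notMem_finset
    (insert a (S ∪ (G.word.map Letter.crossing).toFinset))
  simp only [Finset.mem_insert, Finset.mem_union, List.mem_toFinset, List.mem_map, not_or,
    not_exists, not_and] at ha hb
  refine ⟨a, b, ha.1, hb.2.1, ?_⟩
  have ha' : ∀ z ∈ G.word, z.crossing ≠ a := ha.2
  have hb' : ∀ z ∈ G.word, z.crossing ≠ b := hb.2.2
  have hab : a ≠ b := Ne.symm hb.1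
  have hG := G.isGaussCode
  have hC'w : (⟨c, false, p⟩ : Letter) ∈ G.word := by simp [hword]
  have hDw : (⟨d, true, q⟩ : Letter) ∈ G.word := by simp [hword]
  have hCw : (⟨c, true, p⟩ : Letter) ∈ G.word := hG.2 _ hC'w
  have hD'w : (⟨d, false, q⟩ : Letter) ∈ G.word := hG.2 _ hDw
  have hca : c ≠ a := ha' _ hCw
  have hcb : c ≠ b := hb' _ hCw
  have hda : d ≠ a := ha' _ hDw
  have hdb : d ≠ b := hb' _ hDw
  have hnext : G.word.formPerm ⟨c, false, p⟩ = ⟨d, true, q⟩ := by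
    have := hG.nodup
    rw [hword] at this ⊢
    exact formPerm_apply_of_append this
  -- the word, read from the over-passage of `c`
  obtain ⟨u, t, hrot⟩ : ∃ u t, G.word ~r (⟨c, true, p⟩ :: u ++ ⟨d, false, q⟩ :: t) := by
    obtain ⟨s, s', hs⟩ := List.append_of_mem hCw
    have hr : G.word ~r (⟨c, true, p⟩ :: (s' ++ s)) := by
      rw [hs]
      exact List.isRotated_append
    have hmem : (⟨d, false, q⟩ : Letter) ∈ s' ++ s := by
      have := hr.mem_iff.1 hD'w
      simpa using this
    obtain ⟨u, t, hut⟩ := List.append_of_mem hmem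
    exact ⟨u, t, by rw [hut] at hr; exact hr⟩
  set w := (⟨c, true, p⟩ :: u ++ ⟨d, false, q⟩ :: t : List Letter) with hw
  have hwG : IsGaussCode w := hG.perm hrot.perm
  have hwpl : IsPlanar w := G.isPlanar.isRotated hG hrot
  have hmemw : ∀ z, z ∈ w ↔ z ∈ G.word := fun z => hrot.mem_iff.symm
  have hnextw : w.formPerm ⟨c, false, p⟩ = ⟨d, true, q⟩ := by
    rw [← List.formPerm_eq_of_isRotated hG.nodup hrot, hnext]
  -- push the finger
  set v := directed p [⟨c, true, p⟩, ⟨a, true, p * q⟩, ⟨b, true, -(p * q)⟩] ++ u ++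
      directed (-q) [⟨d, false, q⟩, ⟨a, false, p * q⟩, ⟨b, false, -(p * q)⟩] ++ t with hv
  have hperm := perm_finger c d a b p q _ _ u t
    (directed_perm p [⟨c, true, p⟩, ⟨a, true, p * q⟩, ⟨b, true, -(p * q)⟩])
    (directed_perm (-q) [⟨d, false, q⟩, ⟨a, false, p * q⟩, ⟨b, false, -(p * q)⟩])
  rw [← hw, ← hv] at hperm
  have haw : ∀ z ∈ w, z.crossing ≠ a := fun z hz => ha' z ((hmemw z).1 hz)
  have hbw : ∀ z ∈ w, z.crossing ≠ b := fun z hz => hb' z ((hmemw z).1 hz)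
  have hvG : IsGaussCode v := isGaussCode_of_perm_finger hwG haw hbw hab hperm
  obtain ⟨hvpl, fA, fa, fb⟩ := isPlanar_finger hw hv hwG hwpl haw hbw hab hcd hnextw
  have hmemv : ∀ z, z ∈ v ↔ z = ⟨a, true, p * q⟩ ∨ z = ⟨a, false, p * q⟩ ∨
      z = ⟨b, true, -(p * q)⟩ ∨ z = ⟨b, false, -(p * q)⟩ ∨ z ∈ G.word := by
    intro z
    rw [hperm.mem_iff]
    simp only [List.mem_cons, hmemw]
  let F : Diagram := ⟨v, hvG, hvpl⟩
  have hF : F.knot = G.knot := by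
    obtain ⟨w₁, v₁, h1, h2, h3⟩ := move_finger c d a b p q u t
    exact (knot_eq_of_move (hrot.trans h1) h2 h3).symm
  -- move the strand over the crossing
  set π := triangleSwap ⟨c, true, p⟩ ⟨a, true, p * q⟩ ⟨c, false, p⟩ ⟨d, true, q⟩
      ⟨a, false, p * q⟩ ⟨d, false, q⟩ with hπ
  obtain ⟨p₁, p₁', p₂, p₂', p₃, p₃', hfix⟩ := triangleSwap_spec hcd hca hda hπ
  have hπv : ∀ z ∈ v, π z ∈ v := by
    intro z hz
    by_cases hz' : z ∈ ([⟨c, true, p⟩, ⟨a, true, p * q⟩, ⟨c, false, p⟩, ⟨d, true, q⟩,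
        ⟨a, false, p * q⟩, ⟨d, false, q⟩] : List Letter)
    · simp only [List.mem_cons, List.not_mem_nil, or_false] at hz'
      rcases hz' with rfl | rfl | rfl | rfl | rfl | rfl <;>
        simp [p₁, p₁', p₂, p₂', p₃, p₃', hmemv, hCw, hC'w, hDw, hD'w]
    · rwa [hfix z hz']
  have hpermπ : (v.map π).Perm v := by
    have hs : (v.map π).Subperm v := (hvG.nodup.map π.injective).subperm (by
      intro z hz
      obtain ⟨z', hz', rfl⟩ := List.mem_map.1 hz
      exact hπv z' hz')
    exact hs.perm_of_length_le (by simp)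
  have hπG : IsGaussCode (v.map π) := hvG.perm hpermπ.symm
  have hπpl : IsPlanar (v.map π) := isPlanar_map_triangleSwap hvG hvpl hcd hca hda hπ hpermπ
    (by simp [hmemv, hCw]) (by simp [hmemv, hDw]) (by simp [hmemv]) fA fa fb
  -- the resulting word
  have hid : ∀ l : List Letter, (∀ z ∈ l, z ∈ G.word) → (⟨c, true, p⟩ : Letter) ∉ l →
      (⟨c, false, p⟩ : Letter) ∉ l → (⟨d, true, q⟩ : Letter) ∉ l → (⟨d, false, q⟩ : Letter) ∉ l →
      l.map π = l := by
    intro l h1 h2 h3 h4 h5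
    conv_rhs => rw [← List.map_id l]
    refine List.map_congr_left fun z hz => hfix z fun hz' => ?_
    simp only [List.mem_cons, List.not_mem_nil, or_false] at hz'
    rcases hz' with rfl | rfl | rfl | rfl | rfl | rfl
    · exact h2 hz
    · exact ha' _ (h1 _ hz) rfl
    · exact h3 hz
    · exact h4 hz
    · exact ha' _ (h1 _ hz) rfl
    · exact h5 hz
  have hπb : ∀ o s, π ⟨b, o, s⟩ = ⟨b, o, s⟩ := fun o s => hfix _ (by simp [hcb.symm, hdb.symm, hab.symm])
  have hπC : (directed p [⟨c, true, p⟩, ⟨a, true, p * q⟩, ⟨b, true, -(p * q)⟩]).map π =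
      directed p [⟨a, true, p * q⟩, ⟨c, true, p⟩, ⟨b, true, -(p * q)⟩] := by
    rw [map_directed]
    simp [p₁, p₁', hπb]
  have hπD : (directed (-q) [⟨d, false, q⟩, ⟨a, false, p * q⟩, ⟨b, false, -(p * q)⟩]).map π =
      directed (-q) [⟨a, false, p * q⟩, ⟨d, false, q⟩, ⟨b, false, -(p * q)⟩] := by
    rw [map_directed]
    simp [p₃, p₃', hπb]
  have hwn := hwG.nodup
  rw [hw, List.nodup_append, List.nodup_cons, List.nodup_cons] at hwn
  -- The finger is expressed as a letter-by-letter substitution in the original word, so that a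
  -- division of this word into paths can be carried along.
  have hfv : G.word.flatMap (fingerSubst c d a b p q) ~r v := by
    have := isRotated_flatMap hrot (fingerSubst c d a b p q)
    rw [hw, List.flatMap_append, List.flatMap_cons, List.flatMap_cons, flatMap_eq_self (l := u),
      flatMap_eq_self (l := t)] at this
    · simpa [fingerSubst, hv] using this
    · intro z hz
      have h1 : z ≠ ⟨c, true, p⟩ := fun h =>
        hwn.2.2 _ (List.mem_cons_self) z (List.mem_cons_of_mem _ hz) h.symm
      have h2 : z ≠ ⟨d, false, q⟩ := fun h => hwn.2.1.1 (h ▸ hz)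
      simp [fingerSubst, h1, h2]
    · intro z hz
      have h1 : z ≠ ⟨c, true, p⟩ := fun h => hwn.1.1 (h ▸ hz)
      have h2 : z ≠ ⟨d, false, q⟩ :=
        hwn.2.2 z (List.mem_cons_of_mem _ hz) _ (List.mem_cons_self)
      simp [fingerSubst, h1, h2]
  have hGn := hG.nodup
  rw [hword, List.nodup_append, List.nodup_cons, List.nodup_cons] at hGn
  have hsub : ∀ l : List Letter, (∀ z ∈ l, z ∈ G.word) →
      (⟨c, false, p⟩ : Letter) ∉ l → (⟨d, true, q⟩ : Letter) ∉ l →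
      (l.flatMap (fingerSubst c d a b p q)).map π = l.flatMap (slideSubst c d a b p q) := by
    intro l h1 h2 h3
    rw [List.map_flatMap]
    refine List.flatMap_congr fun z hz => ?_
    unfold fingerSubst slideSubst
    split_ifs with h4 h5
    · exact hπC
    · exact hπD
    · exact hid [z] (by simpa using h1 z hz) (by simpa using Ne.symm h4)
        (by rw [List.mem_singleton]; rintro rfl; exact h2 hz)
        (by rw [List.mem_singleton]; rintro rfl; exact h3 hz)
        (by simpa using Ne.symm h5)
  have hfin : (G.word.flatMap (fingerSubst c d a b p q)).map π =
      x.flatMap (slideSubst c d a b p q) ++ ⟨d, true, q⟩ :: ⟨c, false, p⟩ ::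
          y.flatMap (slideSubst c d a b p q) := by
    rw [← hsub x, ← hsub y]
    · conv_lhs => rw [hword]
      simp [List.flatMap_append, fingerSubst, p₂, p₂', hcd, hcd.symm]
    · intro z hz; simp [hword, hz]
    · exact fun h => hGn.2.1.1 (List.mem_cons_of_mem _ h)
    · exact hGn.2.1.2.1
    · intro z hz; simp [hword, hz]
    · exact fun h => hGn.2.2 _ h _ List.mem_cons_self rfl
    · exact fun h => hGn.2.2 _ h _ (List.mem_cons_of_mem _ List.mem_cons_self) rfl
  have hrotE := hfv.map π
  rw [hfin] at hrotE
  let E : Diagram := ⟨_, hπG.perm hrotE.perm.symm, hπpl.isRotated hπG hrotE.symm⟩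
  refine ⟨E, ?_, rfl⟩
  rw [← hF]
  have hEv : E.word ~r v.map π := hrotE
  -- The middle strand of the triangle lies before or after the bottom strand when the word is read
  -- from the top strand; these are the cyclic orders of `Move.r3` and `Move.r3'`.
  have hut : (⟨c, false, p⟩ : Letter) ∈ u ∨ (⟨c, false, p⟩ : Letter) ∈ t := by
    have := (hmemw _).2 hC'w
    simpa [hw, hcd] using this
  have huw : ∀ z ∈ u, z ∈ G.word := fun z hz => (hmemw z).1 (by simp [hw, hz])
  have htw : ∀ z ∈ t, z ∈ G.word := fun z hz => (hmemw z).1 (by simp [hw, hz])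
  have hwn' := hwG.nodup
  have hnot : ∀ {L : Letter} {l : List Letter}, (w.count L ≤ 1 → l.count L < 1) → L ∉ l := by
    intro L l h hL
    have h1 := h (List.nodup_iff_count_le_one.1 hwn' L)
    have h2 := List.count_pos_iff.2 hL
    omega
  rcases hut with hu | ht
  · obtain ⟨u₁, u₂, rfl⟩ := List.append_of_mem hu
    obtain ⟨u₃, rfl⟩ : ∃ u', u₂ = ⟨d, true, q⟩ :: u' := by
      rcases u₂ with _ | ⟨z, u₃⟩
      · have h := formPerm_apply_of_append (s := ⟨c, true, p⟩ :: u₁) (x := ⟨c, false, p⟩)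
          (y := ⟨d, false, q⟩) (t := t) (by simpa [hw] using hwn')
        rw [hw] at hnextw
        simp only [List.cons_append, List.append_assoc, List.nil_append] at h hnextw
        rw [h] at hnextw
        simp at hnextw
      · have h := formPerm_apply_of_append (s := ⟨c, true, p⟩ :: u₁) (x := ⟨c, false, p⟩)
          (y := z) (t := u₃ ++ ⟨d, false, q⟩ :: t) (by simpa [hw] using hwn')
        rw [hw] at hnextw
        simp only [List.cons_append, List.append_assoc, List.nil_append] at h hnextw
        rw [h] at hnextw
        exact ⟨u₃, by rw [hnextw]⟩
    obtain ⟨w₁, v₁, h1, h2, h3⟩ := move_triangle c d a b p q u₁ u₃ t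
    refine (knot_eq_of_move (D := F) (E := E) (u := w₁) (v := v₁) ?_ ?_ h3).symm
    · refine List.IsRotated.trans ?_ h1
      change v ~r _
      rw [hv]
      simp [List.append_assoc, List.IsRotated.refl]
    · refine (hEv.trans ?_).trans h2
      rw [hv, List.map_append, List.map_append, List.map_append, hπC, hπD, List.map_append,
        List.map_cons, List.map_cons, hid u₁, hid u₃, hid t, p₂, p₂']
      · simp [List.append_assoc, List.IsRotated.refl]
      all_goals first
        | exact htw
        | exact fun z hz => huw z (by simp only [List.mem_append, List.mem_cons, hz]; tauto)
        | (refine hnot ?_; simp [hw, List.count_append, List.count_cons]; omega)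
  · obtain ⟨t₁, t₂, rfl⟩ := List.append_of_mem ht
    obtain ⟨t₃, rfl⟩ : ∃ t', t₂ = ⟨d, true, q⟩ :: t' := by
      rcases t₂ with _ | ⟨z, t₃⟩
      · have h := List.formPerm_cons_concat_apply_last (⟨c, true, p⟩ : Letter) ⟨c, false, p⟩
          (u ++ ⟨d, false, q⟩ :: t₁)
        rw [hw] at hnextw
        simp only [List.cons_append, List.append_assoc, List.nil_append] at h hnextw
        rw [h] at hnextw
        simp [hcd] at hnextw
      · have h := formPerm_apply_of_append (s := ⟨c, true, p⟩ :: u ++ ⟨d, false, q⟩ :: t₁)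
          (x := ⟨c, false, p⟩) (y := z) (t := t₃) (by simpa [hw] using hwn')
        rw [hw] at hnextw
        simp only [List.cons_append, List.append_assoc, List.nil_append] at h hnextw
        rw [h] at hnextw
        exact ⟨t₃, by rw [hnextw]⟩
    obtain ⟨w₁, v₁, h1, h2, h3⟩ := move_triangle' c d a b p q u t₁ t₃
    refine (knot_eq_of_move (D := F) (E := E) (u := w₁) (v := v₁) ?_ ?_ h3).symm
    · refine List.IsRotated.trans ?_ h1
      change v ~r _
      rw [hv]
      simp [List.append_assoc, List.IsRotated.refl]
    · refine (hEv.trans ?_).trans h2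
      rw [hv, List.map_append, List.map_append, List.map_append, hπC, hπD, List.map_append,
        List.map_cons, List.map_cons, hid u, hid t₁, hid t₃, p₂, p₂']
      · simp [List.append_assoc, List.IsRotated.refl]
      all_goals first
        | exact huw
        | exact fun z hz => htw z (by simp only [List.mem_append, List.mem_cons, hz]; tauto)
        | (refine hnot ?_; simp [hw, List.count_append, List.count_cons]; omega)

/-! ### Separating over- and under-passages -/

/-- The relation between a passage `x` and a later passage `y` of the same path: the over-passages
of the crossings outside `E` are preceded by over-passages only, and the passages of the crossings
in `E` follow the times `t`. -/
def Separated (E : Finset ℕ) (t : Letter → ℝ) (x y : Letter) : Prop :=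
  (y.isOver = true → y.crossing ∉ E → x.isOver = true) ∧
    (x.crossing ∈ E → y.crossing ∈ E → t x < t y)

theorem exists_over_append_under {l : List Letter}
    (h : l.Pairwise fun x y => y.isOver = true → x.isOver = true) :
    ∃ o u, l = o ++ u ∧ (∀ x ∈ o, x.isOver = true) ∧ ∀ x ∈ u, x.isOver = false := by
  induction l with
  | nil => exact ⟨[], [], by simp⟩
  | cons x l ih =>
    rw [List.pairwise_cons] at h
    by_cases hx : x.isOver = true
    · obtain ⟨o, u, rfl, ho, hu⟩ := ih h.2
      exact ⟨x :: o, u, rfl, by simpa [hx] using ho, hu⟩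
    · refine ⟨[], x :: l, rfl, by simp, ?_⟩
      intro y hy
      rcases List.mem_cons.1 hy with rfl | hy
      · simpa using hx
      · by_contra hy'
        exact hx (h.1 y hy (by simpa using hy'))

theorem pairwise_swap_adjacent {R : Letter → Letter → Prop} {s t : List Letter} {x y : Letter}
    (h : (s ++ x :: y :: t).Pairwise R) (hyx : R y x) : (s ++ y :: x :: t).Pairwise R := by
  rw [List.pairwise_append, List.pairwise_cons, List.pairwise_cons] at h ⊢
  obtain ⟨h1, ⟨h2, h3, h4⟩, h5⟩ := h
  refine ⟨h1, ⟨fun z hz => ?_, fun z hz => h2 z (List.mem_cons_of_mem _ hz), h4⟩,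
    fun z hz z' hz' => h5 z hz z' ?_⟩
  · rcases List.mem_cons.1 hz with rfl | hz
    · exact hyx
    · exact h3 z hz
  · simp only [List.mem_cons] at hz' ⊢
    tauto

theorem flatten_map_flatMap (f : Letter → List Letter) (L : List (List Letter)) :
    (L.map fun l => l.flatMap f).flatten = L.flatten.flatMap f := by
  induction L with
  | nil => rfl
  | cons l L ih => simp [List.flatMap_append, ih]

theorem mem_directed {g : ℤˣ} {l : List Letter} {x : Letter} : x ∈ directed g l ↔ x ∈ l :=
  (directed_perm g l).mem_iff

section Slide

variable {E : Finset ℕ} {t : Letter → ℝ} {c d a b : ℕ} {p q : ℤˣ}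

/-- New letters appear only beside the over-passage of `c`, with `c ∉ E`, or beside the
under-passage of `d`. The last clause is confined to over-passages because `d` may belong to `E`. -/
theorem mem_slideSubst (hc : c ∉ E) (ha : a ∉ E) (hb : b ∉ E) {x x' : Letter}
    (h : x' ∈ slideSubst c d a b p q x) :
    x'.isOver = x.isOver ∧
      (x' = x ∨ (x'.crossing ∉ E ∧ (x.isOver = true → x.crossing ∉ E))) := by
  unfold slideSubst at h
  split_ifs at h with h1 h2
  · rw [mem_directed] at h
    simp only [List.mem_cons, List.not_mem_nil, or_false] at h
    subst h1
    rcases h with rfl | rfl | rfl <;> simp [hc, ha, hb]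
  · rw [mem_directed] at h
    simp only [List.mem_cons, List.not_mem_nil, or_false] at h
    subst h2
    rcases h with rfl | rfl | rfl <;> simp [ha, hb]
  · simp only [List.mem_cons, List.not_mem_nil, or_false] at h
    simp [h]

/-- New letters take the place of a letter of the same kind, and since they lie outside `E` no times
are compared for them. The new over-passages stand with that of `c`, which, being outside `E`,
already had only over-passages before it. -/
theorem pairwise_flatMap_slideSubst (hc : c ∉ E) (ha : a ∉ E) (hb : b ∉ E) {l : List Letter}
    (h : l.Pairwise (Separated E t)) :
    (l.flatMap (slideSubst c d a b p q)).Pairwise (Separated E t) := by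
  rw [List.pairwise_flatMap]
  constructor
  · intro x _
    unfold slideSubst
    split_ifs
    · unfold directed
      split_ifs <;> simp [Separated, hc, ha, hb]
    · unfold directed
      split_ifs <;> simp [Separated, ha, hb]
    · simp
  · refine h.imp fun {x y} hxy x' hx' y' hy' => ?_
    obtain ⟨h1, h2⟩ := mem_slideSubst hc ha hb hx'
    obtain ⟨h3, h4⟩ := mem_slideSubst hc ha hb hy'
    constructor
    · intro h5 h6
      rw [h1]
      refine hxy.1 (h3 ▸ h5) ?_
      rcases h4 with rfl | h4
      · exact h6
      · exact h4.2 (h3 ▸ h5)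
    · intro h5 h6
      rcases h2 with rfl | h2
      · rcases h4 with rfl | h4
        · exact hxy.2 h5 h6
        · exact absurd h6 h4.1
      · exact absurd h5 h2.1

end Slide

/-- The passages before the over-passage `D` of its path can be made over-passages. -/
theorem exists_over_before {E : Finset ℕ} {t : Letter → ℝ} {D : Letter} (hD : D.isOver = true)
    (hDE : D.crossing ∈ E) (Q : List Letter) :
    ∀ (G : Diagram) (L₁ L₂ : List (List Letter)) (O S : List Letter),
      (L₁ ++ (O ++ Q ++ D :: S) :: L₂).flatten = G.word →
      (∀ p ∈ L₁ ++ (O ++ Q ++ D :: S) :: L₂, p.Pairwise (Separated E t)) →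
      (∀ x ∈ G.word, x.isOver = true → x.crossing ∈ E → t x < t x.other) →
      (∀ x ∈ O, x.isOver = true) →
      (∀ x ∈ Q, x.isOver = false ∧ x.crossing ∉ E) →
      ∃ (G' : Diagram) (L₁' L₂' : List (List Letter)) (O' S' : List Letter),
        G'.knot = G.knot ∧ L₁'.length = L₁.length ∧ L₂'.length = L₂.length ∧
        (L₁' ++ (O' ++ D :: S') :: L₂').flatten = G'.word ∧
        (∀ p ∈ L₁' ++ (O' ++ D :: S') :: L₂', p.Pairwise (Separated E t)) ∧
        (∀ x ∈ G'.word, x.isOver = true → x.crossing ∈ E → t x < t x.other) ∧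
        (∀ x ∈ O', x.isOver = true) := by
  -- `D` passes the last letter of `Q` first.
  induction Q using List.reverseRecOn with
  | nil =>
    intro G L₁ L₂ O S h1 h2 h3 h4 _
    exact ⟨G, L₁, L₂, O, S, rfl, rfl, rfl, by simpa using h1, by simpa using h2, h3, h4⟩
  | append_singleton Q C ih =>
    intro G L₁ L₂ O S h1 h2 h3 h4 h5
    obtain ⟨d, o, q⟩ := D
    obtain ⟨c, o', p⟩ := C
    simp only at hD hDE
    have hC := h5 ⟨c, o', p⟩ (by simp)
    simp only at hC
    obtain ⟨rfl, hc⟩ := hC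
    subst hD
    have hcd : c ≠ d := by rintro rfl; exact hc hDE
    have hword : G.word = (L₁.flatten ++ (O ++ Q)) ++ ⟨c, false, p⟩ :: ⟨d, true, q⟩ ::
        (S ++ L₂.flatten) := by
      rw [← h1]
      simp
    obtain ⟨a, b, ha, hb, G', hk, hw⟩ := exists_slide G E hword hcd
    -- The slide adds nothing to `Q`: the over-passage of `c` is of the wrong kind to lie there, and
    -- the under-passage of `d` belongs to a crossing in `E`. Hence the block before `D` really
    -- becomes shorter.
    have hQ : Q.flatMap (slideSubst c d a b p q) = Q := by
      refine flatMap_eq_self fun z hz => ?_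
      have hz' := h5 z (by simp [hz])
      have n1 : z ≠ ⟨c, true, p⟩ := by rintro rfl; simp at hz'
      have n2 : z ≠ ⟨d, false, q⟩ := by rintro rfl; exact hz'.2 hDE
      simp [slideSubst, n1, n2]
    have hmem : ∀ x ∈ G'.word, ∃ z ∈ G.word, x = z ∨ x ∈ slideSubst c d a b p q z := by
      intro x hx
      rw [hw] at hx
      rw [List.mem_append, List.mem_cons, List.mem_cons, List.mem_flatMap, List.mem_flatMap] at hx
      rw [hword]
      rcases hx with ⟨z, hz, h⟩ | rfl | rfl | ⟨z, hz, h⟩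
      · exact ⟨z, List.mem_append_left _ hz, Or.inr h⟩
      · exact ⟨_, by simp, Or.inl rfl⟩
      · exact ⟨_, by simp, Or.inl rfl⟩
      · exact ⟨z, List.mem_append_right _ (List.mem_cons_of_mem _ (List.mem_cons_of_mem _ hz)),
          Or.inr h⟩
    obtain ⟨G'', L₁', L₂', O', S', k1, k2, k3, k4⟩ := ih G'
      (L₁.map fun l => l.flatMap (slideSubst c d a b p q))
      (L₂.map fun l => l.flatMap (slideSubst c d a b p q))
      (O.flatMap (slideSubst c d a b p q))
      (⟨c, false, p⟩ :: S.flatMap (slideSubst c d a b p q))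
      (by
        rw [hw]
        simp [List.flatMap_append, flatten_map_flatMap, hQ])
      (by
        intro l hl
        have hF : ∀ l ∈ L₁ ++ (O ++ (Q ++ [⟨c, false, p⟩]) ++ ⟨d, true, q⟩ :: S) :: L₂,
            (l.flatMap (slideSubst c d a b p q)).Pairwise (Separated E t) :=
          fun l hl => pairwise_flatMap_slideSubst hc ha hb (h2 l hl)
        simp only [List.mem_append, List.mem_cons, List.mem_map] at hl hF
        rcases hl with ⟨l, hl, rfl⟩ | rfl | ⟨l, hl, rfl⟩
        · exact hF l (Or.inl hl)
        · have h6 := hF _ (Or.inr (Or.inl rfl))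
          rw [List.flatMap_append, List.flatMap_append, List.flatMap_append, hQ] at h6
          have e1 : slideSubst c d a b p q ⟨c, false, p⟩ = [⟨c, false, p⟩] := by
            simp [slideSubst, hcd]
          have e2 : slideSubst c d a b p q ⟨d, true, q⟩ = [⟨d, true, q⟩] := by
            simp [slideSubst, hcd.symm]
          rw [List.flatMap_cons, List.flatMap_cons, List.flatMap_nil, e1, e2] at h6
          have h7 : Separated E t ⟨d, true, q⟩ ⟨c, false, p⟩ := by simp [Separated, hc]
          have h8 := pairwise_swap_adjacent
            (s := O.flatMap (slideSubst c d a b p q) ++ Q) (by simpa using h6) h7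
          simpa using h8
        · exact hF l (Or.inr (Or.inr hl)))
      (by
        intro x hx hxo hxE
        obtain ⟨z, hz, rfl | h⟩ := hmem x hx
        · exact h3 _ hz hxo hxE
        · obtain ⟨-, rfl | h⟩ := mem_slideSubst hc ha hb h
          · exact h3 _ hz hxo hxE
          · exact absurd hxE h.1)
      (by
        intro x hx
        obtain ⟨z, hz, h⟩ := List.mem_flatMap.1 hx
        rw [(mem_slideSubst hc ha hb h).1]
        exact h4 z hz)
      (fun x hx => h5 x (by simp [hx]))
    exact ⟨G'', L₁', L₂', O', S', k1.trans hk, by simpa using k2, by simpa using k3, k4⟩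

/-- A diagram with a separated family of paths can be transformed into one each of whose paths
consists of over-passages followed by under-passages. -/
theorem exists_over_under_paths (t : Letter → ℝ) (E : Finset ℕ) :
    ∀ (G : Diagram) (L : List (List Letter)), L.flatten = G.word →
      (∀ p ∈ L, p.Pairwise (Separated E t)) →
      (∀ x ∈ G.word, x.isOver = true → x.crossing ∈ E → t x < t x.other) →
      ∃ (G' : Diagram) (L' : List (List Letter)), G'.knot = G.knot ∧ L'.length = L.length ∧
        L'.flatten = G'.word ∧
        ∀ p ∈ L', p.Pairwise fun x y => y.isOver = true → x.isOver = true := by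
  induction E using Finset.strongInduction with
  | H E ih =>
    intro G L h1 h2 h3
    by_cases hex : ∃ x ∈ G.word, x.isOver = true ∧ x.crossing ∈ E
    · obtain ⟨D, hD, hmin⟩ := (G.word.toFinset.filter fun x => x.isOver = true ∧ x.crossing ∈ E
        ).exists_min_image t (by
          obtain ⟨x, hx, hx'⟩ := hex
          exact ⟨x, by simpa using ⟨hx, hx'⟩⟩)
      simp only [Finset.mem_filter, List.mem_toFinset, and_imp] at hD hmin
      obtain ⟨hDw, hDo, hDE⟩ := hD
      have hDw' := hDw
      rw [← h1] at hDw'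
      obtain ⟨p, hp, hDp⟩ := List.mem_flatten.1 hDw'
      obtain ⟨L₁, L₂, rfl⟩ := List.append_of_mem hp
      obtain ⟨P, S, rfl⟩ := List.append_of_mem hDp
      have hsep := h2 _ hp
      rw [List.pairwise_append] at hsep
      have hPw : ∀ x ∈ P, x ∈ G.word := by
        intro x hx
        rw [← h1]
        simp [hx]
      -- A passage before `D` with crossing in `E` would be earlier than `D`. If it is an
      -- over-passage, this contradicts the choice of `D`; if it is an under-passage, the dance rule
      -- makes its over-passage earlier still.
      have hPE : ∀ x ∈ P, x.crossing ∉ E := by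
        intro x hx hxE
        have hlt := (hsep.2.2 x hx D (by simp)).2 hxE hDE
        by_cases hxo : x.isOver = true
        · exact absurd hlt (not_lt.2 (hmin x (hPw x hx) hxo hxE))
        · have hyo : x.other.isOver = true := by simpa [Letter.other] using hxo
          have hyw := G.isGaussCode.2 x (hPw x hx)
          have hy := h3 _ hyw hyo hxE
          rw [Letter.other_other] at hy
          have := hmin _ hyw hyo hxE
          linarith
      obtain ⟨O, Q, rfl, hO, hQ⟩ := exists_over_append_under (l := P)
        (hsep.1.imp_of_mem fun {x y} _ hy hxy hyo => hxy.1 hyo (hPE y hy))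
      obtain ⟨G', L₁', L₂', O', S', k1, k2, k3, k4, k5, k6, k7⟩ := exists_over_before hDo hDE Q
        G L₁ L₂ O S h1 h2 h3 hO (fun x hx => ⟨hQ x hx, hPE x (by simp [hx])⟩)
      have hnd := G'.isGaussCode.nodup
      have hDw'' : D ∈ G'.word := by rw [← k4]; simp
      have huniq : ∀ y ∈ G'.word, y.isOver = true → y.crossing = D.crossing → y = D :=
        fun y hy hyo hyc => G'.isGaussCode.eq_of_mem hy hDw'' hyc (hyo.trans hDo.symm)
      rw [← k4] at hnd huniq
      obtain ⟨G'', L'', e1, e2, e3, e4⟩ := ih (E.erase D.crossing) (Finset.erase_ssubset hDE) G'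
        (L₁' ++ (O' ++ D :: S') :: L₂') k4 (by
          -- Removing the crossing of `D` from `E` creates a new requirement only at the
          -- over-passage `D` itself, so paths without `D` remain separated.
          have hother : ∀ p : List Letter, D ∉ p →
              (∀ y ∈ p, y ∈ (L₁' ++ (O' ++ D :: S') :: L₂').flatten) →
              p.Pairwise (Separated E t) → p.Pairwise (Separated (E.erase D.crossing) t) := by
            intro p hDp hpw hpp
            refine hpp.imp_of_mem fun {x y} hx hy hxy => ⟨fun hyo hyE => ?_, fun hxE hyE =>
              hxy.2 (Finset.mem_of_mem_erase hxE) (Finset.mem_of_mem_erase hyE)⟩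
            refine hxy.1 hyo fun hyE' => ?_
            have hyc : y.crossing = D.crossing := by
              by_contra hne
              exact hyE (Finset.mem_erase.2 ⟨hne, hyE'⟩)
            exact hDp (huniq y (hpw y hy) hyo hyc ▸ hy)
          simp only [List.flatten_append, List.flatten_cons] at hnd
          intro p hp
          have hpp := k5 p hp
          have hp' := hp
          rw [List.mem_append, List.mem_cons] at hp
          rcases hp with hp | rfl | hp
          · refine hother p (fun hDp => ?_) (fun y hy => List.mem_flatten.2 ⟨p, hp', hy⟩) hpp
            rw [List.nodup_append] at hnd
            exact hnd.2.2 D (List.mem_flatten.2 ⟨p, hp, hDp⟩) D (by simp) rfl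
          · rw [List.pairwise_append, List.pairwise_cons] at hpp ⊢
            have hS : D ∉ S' := by
              intro h
              rw [List.nodup_append, List.nodup_append, List.nodup_append, List.nodup_cons] at hnd
              exact hnd.2.1.1.2.1.1 h
            have hle : ∀ x y, Separated E t x y → x.isOver = true →
                Separated (E.erase D.crossing) t x y := fun x y h hx => ⟨fun _ _ => hx,
              fun hxE hyE => h.2 (Finset.mem_of_mem_erase hxE) (Finset.mem_of_mem_erase hyE)⟩
            refine ⟨hpp.1.imp_of_mem fun {x y} hx _ h => hle x y h (k7 x hx),
              ⟨fun y hy => hle D y (hpp.2.1.1 y hy) hDo, hother S' hS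
                (fun y hy => by simp [hy]) hpp.2.1.2⟩,
              fun x hx y hy => hle x y (hpp.2.2 x hx y hy) (k7 x hx)⟩
          · refine hother p (fun hDp => ?_) (fun y hy => List.mem_flatten.2 ⟨p, hp', hy⟩) hpp
            rw [List.nodup_append, List.nodup_append] at hnd
            exact hnd.2.1.2.2 D (by simp) D (List.mem_flatten.2 ⟨p, hp, hDp⟩) rfl)
        (fun x hx hxo hxE => k6 x hx hxo (Finset.mem_of_mem_erase hxE))
      exact ⟨G'', L'', e1.trans k1, by simp [e2, k2, k3], e3, e4⟩
    · push Not at hex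
      refine ⟨G, L, rfl, rfl, h1, fun p hp => (h2 p hp).imp_of_mem fun {x y} _ hy hxy hyo =>
        hxy.1 hyo (hex y ?_ hyo)⟩
      rw [← h1]
      exact List.mem_flatten.2 ⟨p, hp, hy⟩

/-! ### Bridges and dances -/

/-- The over-passages of the path precede its under-passages. -/
def OverUnder (p : List Letter) : Prop := p.Pairwise fun x y => y.isOver = true → x.isOver = true

/-- A bridge begins with an over-passage directly after an under-passage. Such a pair cannot lie
within one path, so the over-passage is the head of its path, and distinct bridges have distinct
heads. -/
theorem bridgeNumber_le_of_overUnder (G : Diagram) {L : List (List Letter)}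
    (hL : L.flatten = G.word) (h : ∀ p ∈ L, OverUnder p) : G.bridgeNumber ≤ L.length := by
  have hnd := G.isGaussCode.nodup
  unfold Diagram.bridgeNumber
  rw [List.countP_eq_length_filter, ← List.length_map (f := G.word.formPerm)]
  refine le_trans ?_ (List.length_filterMap_le List.head? L)
  refine List.Subperm.length_le (List.Nodup.subperm
    ((hnd.filter _).map G.word.formPerm.injective) fun y hy => ?_)
  obtain ⟨x, hx, rfl⟩ := List.mem_map.1 hy
  rw [List.mem_filter] at hx
  obtain ⟨hxw, hx⟩ := hx
  simp only [Bool.and_eq_true, Bool.not_eq_true'] at hx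
  have hyw : G.word.formPerm x ∈ G.word := List.formPerm_apply_mem_of_mem hxw
  generalize hgen : G.word.formPerm x = y at *
  rw [← hL] at hyw
  obtain ⟨p, hp, hyp⟩ := List.mem_flatten.1 hyw
  obtain ⟨s, r, rfl⟩ := List.append_of_mem hyp
  rcases List.eq_nil_or_concat s with rfl | ⟨s', z, rfl⟩
  · exact List.mem_filterMap.2 ⟨_, hp, rfl⟩
  · exfalso
    obtain ⟨L₁, L₂, rfl⟩ := List.append_of_mem hp
    have hw : G.word = (L₁.flatten ++ s') ++ z :: y :: (r ++ L₂.flatten) := by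
      rw [← hL]; simp
    have hzy : G.word.formPerm z = y := by
      rw [hw] at hnd ⊢
      exact formPerm_apply_of_append hnd
    have hzx : z = x := G.word.formPerm.injective (hzy.trans hgen.symm)
    have h' := h _ hp
    simp only [OverUnder, List.concat_eq_append] at h'
    have hz := (List.pairwise_append.1 h').2.2 z (by simp) y (by simp) hx.2
    rw [hzx, hx.1] at hz
    exact Bool.noConfusion hz

theorem exists_last_under {l : List Letter} (h : ∃ x ∈ l, x.isOver = false) :
    ∃ a x o, l = a ++ x :: o ∧ x.isOver = false ∧ ∀ y ∈ o, y.isOver = true := by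
  induction l with
  | nil => simp at h
  | cons y l ih =>
    by_cases h' : ∃ x ∈ l, x.isOver = false
    · obtain ⟨a, x, o, rfl, hx, ho⟩ := ih h'
      exact ⟨y :: a, x, o, rfl, hx, ho⟩
    · push Not at h'
      refine ⟨[], y, l, rfl, ?_, by simpa using h'⟩
      obtain ⟨x, hx, hxo⟩ := h
      rcases List.mem_cons.1 hx with rfl | hx
      · exact hxo
      · exact absurd hxo (h' x hx)

/-- A diagram with crossings can be read from a bridge. -/
theorem exists_isRotated_over_under {w : List Letter} (hw : IsGaussCode w) (hne : w ≠ []) :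
    ∃ y l x, w ~r (y :: (l ++ [x])) ∧ y.isOver = true ∧ x.isOver = false := by
  obtain ⟨z, hz⟩ := List.exists_mem_of_ne_nil w hne
  have hO : ∃ x ∈ w, x.isOver = true := by
    by_cases h : z.isOver = true
    · exact ⟨z, hz, h⟩
    · exact ⟨z.other, hw.2 z hz, by simpa [Letter.other] using h⟩
  obtain ⟨x, hx, hxo⟩ := hO
  obtain ⟨s, t, rfl⟩ := List.append_of_mem hx
  have hr : (s ++ x :: t) ~r (x :: (t ++ s)) := by
    simpa using List.isRotated_append (l := s) (l' := x :: t)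
  obtain ⟨a, u, o, he, hu, ho⟩ := exists_last_under (l := x :: (t ++ s))
    ⟨x.other, hr.mem_iff.1 (hw.2 x hx), by simp [Letter.other, hxo]⟩
  have hr' : (s ++ x :: t) ~r (o ++ (a ++ [u])) := by
    refine hr.trans ?_
    rw [he]
    simpa using List.isRotated_append (l := a ++ [u]) (l' := o)
  rcases o with _ | ⟨y, o⟩
  · rcases a with _ | ⟨y, a⟩
    · simp only [List.nil_append, List.cons.injEq] at he
      rw [← he.1, hxo] at hu
      exact Bool.noConfusion hu
    · simp only [List.cons_append, List.cons.injEq] at he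
      exact ⟨y, a, u, by simpa using hr', he.1 ▸ hxo, hu⟩
  · exact ⟨y, o ++ a, u, by simpa using hr', ho y (by simp), hu⟩

theorem pairwise_idxOf_lt {l : List Letter} (h : l.Nodup) :
    l.Pairwise fun x y => l.idxOf x < l.idxOf y := by
  rw [List.pairwise_iff_getElem]
  intro i j hi hj hij
  rwa [h.idxOf_getElem, h.idxOf_getElem]

/-- Passages are timed by their position in the word, with the length of the word added for
under-passages; every over-passage then precedes every under-passage. -/
theorem hasDance_of_overUnder (G : Diagram) {L : List (List Letter)} (hL : L.flatten ~r G.word)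
    (h : ∀ p ∈ L, OverUnder p) (h1 : 1 ≤ L.length) : G.HasDance .overFirst L.length := by
  set w := L.flatten with hw
  have hnd : w.Nodup := hL.nodup_iff.2 G.isGaussCode.nodup
  refine ⟨L, rfl, h1, hL, fun x => (w.idxOf x : ℝ) + if x.isOver then (0 : ℝ) else w.length, ?_, ?_⟩
  · intro p hp
    have hp' := (pairwise_idxOf_lt hnd).sublist (List.sublist_flatten_of_mem hp)
    refine hp'.imp₂ (fun x y hxy hxy' => ?_) (h p hp)
    have hxy'' : (w.idxOf x : ℝ) < w.idxOf y := by exact_mod_cast hxy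
    have hlen : (0 : ℝ) ≤ w.length := by positivity
    simp only
    split_ifs with h1 h2 h2
    · linarith
    · linarith
    · exact absurd (hxy' h2) h1
    · linarith
  · intro x hx hxo
    have hx' : w.idxOf x < w.length := List.idxOf_lt_length_iff.2 (hL.mem_iff.2 hx)
    have hx'' : (w.idxOf x : ℝ) < w.length := by exact_mod_cast hx'
    have hxo' : x.isOver = true := hxo
    have hpos : (0 : ℝ) ≤ w.idxOf x.other := by positivity
    simp only [hxo', if_true, Letter.other, Bool.not_true, Bool.false_eq_true, if_false, add_zero]
      at hpos ⊢
    linarith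

/-- The word is cut at each step from an under-passage to an over-passage, and each piece is counted
by its last letter, from which a bridge starts. The crossingless diagram is excluded because it has
no bridge but still needs a dancer. -/
theorem exists_hasDance_le_bridgeNumber (G : Diagram) (hne : G.word ≠ []) :
    ∃ n ≤ G.bridgeNumber, G.HasDance .overFirst n := by
  obtain ⟨y, l, x, hr, hy, hx⟩ := exists_isRotated_over_under G.isGaussCode hne
  set w := y :: (l ++ [x]) with hw
  have hnd : w.Nodup := hr.nodup_iff.1 G.isGaussCode.nodup
  let r : Letter → Letter → Bool := fun a b => a.isOver || !b.isOver
  let L := w.splitBy r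
  have hL : L.flatten = w := List.flatten_splitBy r w
  have hnil : ∀ p ∈ L, p ≠ [] := fun p hp h => List.nil_notMem_splitBy r w (h ▸ hp)
  have hlen : (L.filterMap List.getLast?).length = L.length := by
    rw [List.filterMap_length_eq_length]
    intro p hp
    simpa using hnil p hp
  have hsub : ∀ L : List (List Letter), (L.filterMap List.getLast?).Sublist L.flatten := by
    intro L
    induction L with
    | nil => simp
    | cons p L ih =>
      rcases List.eq_nil_or_concat p with rfl | ⟨p', z, rfl⟩
      · rw [List.filterMap_cons, List.flatten_cons]
        exact ih
      · simp only [List.concat_eq_append, List.filterMap_cons, List.getLast?_concat,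
          List.flatten_cons, List.append_assoc, List.singleton_append]
        exact (ih.cons_cons z).trans (List.sublist_append_right _ _)
  refine ⟨L.length, ?_, hasDance_of_overUnder G (by rw [hL]; exact hr.symm) ?_ ?_⟩
  · unfold Diagram.bridgeNumber
    rw [List.formPerm_eq_of_isRotated G.isGaussCode.nodup hr, hr.perm.countP_eq,
      List.countP_eq_length_filter, ← hlen]
    refine List.Subperm.length_le (List.Nodup.subperm (hnd.sublist (hL ▸ hsub L)) fun z hz => ?_)
    obtain ⟨p, hp, hzp⟩ := List.mem_filterMap.1 hz
    obtain ⟨p', rfl⟩ : ∃ p', p = p' ++ [z] := by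
      rcases List.eq_nil_or_concat p with rfl | ⟨p', z', rfl⟩
      · simp at hzp
      · exact ⟨p', by simpa using hzp⟩
    obtain ⟨L₁, L₂, hL'⟩ := List.append_of_mem hp
    rw [hL'] at hL
    refine List.mem_filter.2 ⟨by rw [← hL]; simp, ?_⟩
    -- The end of the last piece is followed cyclically by the first letter of the word; it starts a
    -- bridge because the word is read from an over-passage preceded by an under-passage.
    rcases L₂ with _ | ⟨p₂, L₂⟩
    · have hzx : z = x := by
        have h' : (L₁.flatten ++ p') ++ [z] = (y :: l) ++ [x] := by
          rw [List.cons_append, ← hw, ← hL]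
          simp
        simpa using List.append_inj_right' h' rfl
      rw [hzx, hw, List.formPerm_cons_concat_apply_last]
      simp [hx, hy]
    · have hne₂ : p₂ ≠ [] := hnil p₂ (by rw [hL']; simp)
      obtain ⟨b, p₂', rfl⟩ := List.exists_cons_of_ne_nil hne₂
      have hN : w.formPerm z = b := by
        have hw' : w = (L₁.flatten ++ p') ++ z :: b :: (p₂' ++ L₂.flatten) := by
          rw [← hL]; simp
        rw [hw'] at hnd ⊢
        exact formPerm_apply_of_append hnd
      have hch := List.isChain_getLast_head_splitBy r w
      change List.IsChain _ L at hch
      rw [hL'] at hch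
      have := (List.isChain_append.1 hch).2.1
      rw [List.isChain_cons_cons] at this
      obtain ⟨⟨ha, hb, hab⟩, -⟩ := this
      simp [r] at hab
      rw [hN]
      simp [hab]
  · intro p hp
    have hc := List.isChain_of_mem_splitBy hp
    unfold OverUnder
    have : IsTrans Letter fun x y : Letter => y.isOver = true → x.isOver = true :=
      ⟨fun a b c h1 h2 h3 => h1 (h2 h3)⟩
    rw [← List.isChain_iff_pairwise]
    refine hc.imp fun a b hab hb => ?_
    simpa [r, hb] using hab
  · rw [Nat.one_le_iff_ne_zero]
    intro h0
    rw [List.eq_nil_of_length_eq_zero h0] at hL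
    simp [hw] at hL

theorem hasDance_circle : Diagram.circle.HasDance .overFirst 1 :=
  ⟨[[]], rfl, le_rfl, List.IsRotated.refl _, fun _ => 0, by simp, by simp [Diagram.circle]⟩

theorem eq_circle {G : Diagram} (h : G.word = []) : G = Diagram.circle := by
  cases G
  simp only at h
  subst h
  rfl

/-- This ensures that the infimum in `danceNumber` is attained and is not the default value `0` of
an empty set. -/
theorem exists_hasDance (G : Diagram) : ∃ n, G.HasDance .overFirst n := by
  by_cases h : G.word = []
  · rw [eq_circle h]
    exact ⟨1, hasDance_circle⟩
  · obtain ⟨n, -, hn⟩ := exists_hasDance_le_bridgeNumber G h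
    exact ⟨n, hn⟩

theorem hasDance_danceNumber (G : Diagram) : G.HasDance .overFirst (G.danceNumber .overFirst) :=
  Nat.sInf_mem (exists_hasDance G)

/-- The procedure starts with every crossing in `E`; for this `E` being separated means only that
times increase along each path. -/
theorem exists_bridgeNumber_le {G : Diagram} {n : ℕ} (h : G.HasDance .overFirst n) :
    ∃ G' : Diagram, G'.knot = G.knot ∧ G'.bridgeNumber ≤ n := by
  obtain ⟨L, rfl, -, hr, t, ht, hc⟩ := h
  let F : Diagram := ⟨L.flatten, G.isGaussCode.perm hr.perm.symm,
    G.isPlanar.isRotated G.isGaussCode hr.symm⟩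
  obtain ⟨G', L', h1, h2, h3, h4⟩ := exists_over_under_paths t
    (L.flatten.map Letter.crossing).toFinset F L rfl
    (fun p hp => (ht p hp).imp_of_mem fun {x y} _ hy hxy => ⟨fun _ hyE => absurd
      (List.mem_toFinset.2 (List.mem_map_of_mem (List.mem_flatten.2 ⟨p, hp, hy⟩))) hyE,
      fun _ _ => hxy⟩)
    (fun x hx hxo _ => hc x (hr.mem_iff.1 hx) hxo)
  exact ⟨G', h1.trans (knot_eq_of_isRotated hr), h2 ▸ bridgeNumber_le_of_overUnder G' h3 h4⟩

/-! ### Reversing a diagram -/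

/-- The diagram with the opposite orientation. -/
def Diagram.reverse (G : Diagram) : Diagram :=
  ⟨G.word.reverse, G.isGaussCode.perm G.word.reverse_perm.symm, G.isPlanar.reverse G.isGaussCode⟩

theorem Diagram.knot_reverse (G : Diagram) : G.reverse.knot = G.knot :=
  (Quot.sound (r := fun D E : Diagram => Move D.word E.word) (a := G) (b := G.reverse)
    (Move.reverse G.word)).symm

theorem Diagram.reverse_reverse (G : Diagram) : G.reverse.reverse = G := by
  cases G
  simp [Diagram.reverse]

/-- Running the dance backwards, at times `-t`, reverses the paths and interchanges the first and
second passage at each crossing. -/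
theorem hasDance_reverse {G : Diagram} {r s : Rule} (hrs : ∀ x : Letter, s.first x → r.first x.other)
    {n : ℕ} (h : G.HasDance r n) : G.reverse.HasDance s n := by
  obtain ⟨L, rfl, h1, hr, t, ht, hc⟩ := h
  refine ⟨(L.map List.reverse).reverse, by simp, h1, ?_, fun x => -t x, ?_, ?_⟩
  · rw [← List.reverse_flatten]
    exact hr.reverse
  · intro p hp
    rw [List.mem_reverse, List.mem_map] at hp
    obtain ⟨p, hp, rfl⟩ := hp
    rw [List.pairwise_reverse]
    exact (ht p hp).imp fun h => neg_lt_neg h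
  · intro x hx hxs
    have hx' : x ∈ G.word := List.mem_reverse.1 hx
    have := hc _ (G.isGaussCode.2 x hx') (hrs x hxs)
    rw [Letter.other_other] at this
    exact neg_lt_neg this

theorem danceNumber_reverse (G : Diagram) :
    G.reverse.danceNumber .overFirst = G.danceNumber .underFirst := by
  unfold Diagram.danceNumber
  congr 1
  ext n
  constructor
  · intro h
    have := hasDance_reverse (s := .underFirst) (fun x hx => by
      simpa [Rule.first, Letter.other] using hx) h
    rwa [Diagram.reverse_reverse] at this
  · exact fun h => hasDance_reverse (fun x hx => by simpa [Rule.first, Letter.other] using hx) h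

theorem danceIndex_under_eq_over (K : Knot) :
    danceIndex .underFirst K = danceIndex .overFirst K := by
  unfold danceIndex
  congr 1
  ext n
  constructor
  · rintro ⟨G, hG, hn⟩
    exact ⟨G.reverse, G.knot_reverse.trans hG, (danceNumber_reverse G).trans hn⟩
  · rintro ⟨G, hG, hn⟩
    refine ⟨G.reverse, G.knot_reverse.trans hG, ?_⟩
    rw [← danceNumber_reverse, Diagram.reverse_reverse, hn]

/-! ### Comparison of the two indices -/

theorem danceIndex_le {G : Diagram} {n : ℕ} (h : G.HasDance .overFirst n) :
    danceIndex .overFirst G.knot ≤ n := by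
  have h1 : G.danceNumber .overFirst ≤ n := Nat.sInf_le h
  have h2 : danceIndex .overFirst G.knot ≤ G.danceNumber .overFirst := Nat.sInf_le ⟨G, rfl, rfl⟩
  exact h2.trans h1

theorem danceIndex_over_eq_bridgeIndex (K : Knot) :
    danceIndex .overFirst K = bridgeIndex K := by
  have hne : {n | ∃ G : Diagram, G.knot = K ∧ G.danceNumber .overFirst = n}.Nonempty := by
    obtain ⟨G, rfl⟩ := Quot.exists_rep K
    exact ⟨_, G, rfl, rfl⟩
  have hpos : ∀ G : Diagram, 1 ≤ G.danceNumber .overFirst := fun G => by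
    obtain ⟨_, _, h, _⟩ := hasDance_danceNumber G
    exact h
  obtain ⟨G, hG, hn⟩ : ∃ G : Diagram, G.knot = K ∧
      G.danceNumber .overFirst = danceIndex .overFirst K := Nat.sInf_mem hne
  unfold bridgeIndex
  split_ifs with hK
  -- For the unknot one dancer suffices on the crossingless diagram, and at least one is required by
  -- definition, matching the conventional value `1`.
  · refine le_antisymm ?_ (hn ▸ hpos G)
    rw [hK]
    exact danceIndex_le hasDance_circle
  · refine le_antisymm ?_ ?_
    · obtain ⟨B, hB, hb⟩ := Nat.sInf_mem
        (s := {n | ∃ D : Diagram, D.knot = K ∧ D.bridgeNumber = n}) ⟨_, G, hG, rfl⟩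
      -- A diagram of a nontrivial knot has crossings, hence can be read from a bridge.
      have hBne : B.word ≠ [] := fun h => hK (by rw [← hB, eq_circle h]; rfl)
      obtain ⟨n, hle, hd⟩ := exists_hasDance_le_bridgeNumber B hBne
      rw [← hb]
      exact (hB ▸ danceIndex_le hd).trans hle
    · obtain ⟨B, hB, hb⟩ := exists_bridgeNumber_le (hasDance_danceNumber G)
      rw [← hn]
      refine le_trans (Nat.sInf_le ?_) hb
      exact ⟨B, hB.trans hG, rfl⟩

end Danceability

theorem theorem3p3 (K : Danceability.Knot) :
    Danceability.danceOverIndex K = Danceability.bridgeIndex K ∧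
      Danceability.danceUnderIndex K = Danceability.bridgeIndex K :=
  ⟨Danceability.danceIndex_over_eq_bridgeIndex K,
    (Danceability.danceIndex_under_eq_over K).trans
      (Danceability.danceIndex_over_eq_bridgeIndex K)⟩
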